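/- Let $k$ be an algebraically closed field of characteristic $2$, let $A=k[x,y]/(x^2,y^2)$ with augmentation $\varepsilon(x)=\varepsilon(y)=0$, and let $P$ be $A$ as a module over itself. A group scheme structure $G$ on $A$ is a pair $(\Delta,S)$ of a coassociative cocommutative algebra map $\Delta:A\to A\otimes A$ with counit $\varepsilon$ and an antipode $S$ for it; then $A=kG$ is the group algebra of a finite group scheme, also denoted $G$, and $V\otimes W$ is an $A$-module through $\Delta$ for all $A$-modules $V,W$. Let $\widetilde G,G_1,G_2,G_3$ be the group scheme structures on $A$ with $$\begin{aligned} \widetilde G&:\ \Delta(x)=x\otimes1+1\otimes x,& \Delta(y)&=y\otimes1+1\otimes y,\\ G_1&:\ \Delta(x)=x\otimes1+1\otimes x,& \Delta(y)&=y\otimes1+1\otimes y+x\otimes x,\\ G_2&:\ \Delta(x)=x\otimes1+1\otimes x,& \Delta(y)&=y\otimes1+1\otimes y+y\otimes y,\\ G_3&:\ \Delta(x)=x\otimes1+1\otimes x+x\otimes x,& \Delta(y)&=y\otimes1+1\otimes y+y\otimes y. \end{aligned}$$ For an algebra map $\alpha:k[t]/t^2\to A$ let $\mathfrak p(\alpha)$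 be the radical of the kernel of $H^*(\alpha):H^*(A,k)\to H^*(k[t]/t^2,k)$, where $H^*(-,k)=\operatorname{Ext}^*(k,k)$. The closed points of $\operatorname{Proj}H^*(A,k)$ are identified with $\mathbb P^1=\mathbb P^1(k)$ by writing $[a:b]$ for $\mathfrak p(t\mapsto ax+by)$. A $\pi$-point of $G$ is a flat algebra map $k[t]/t^2\to kG$ that factors through the group algebra of a unipotent abelian subgroup scheme of $G$. A point $\mathfrak p\in\mathbb P^1$ is noble for $G$ if there are a subgroup scheme $C<G$ and an isomorphism $k[t]/t^2\cong kC$ such that the inclusion $\alpha:k[t]/t^2\cong kC\hookrightarrow kG$ is a $\pi$-point with $\mathfrak p(\alpha)=\mathfrak p$. For $\mathfrak p=[a:b]\in\mathbb P^1$ put $s_2=ax+by$, choose $s_1=cx+dy$ such that $s_1,s_2$ are linearly independent, and let $V_{2n}(\mathfrak p)=k^n\oplus k^n$ be the $A$-module on which $s_1$ and $s_2$ act by the block matrices $$s_1:\begin{pmatrix}0&I_n\\0&0\end{pmatrix},\qquad s_2:\begin{pmatrix}0&\mathfrak N_n\\0&0\end{pmatrix},$$ where $\mathfrak N_n$ is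 the upper triangular nilpotent $n\times n$ Jordan block. The support of a finite-dimensional $A$-module $M$ is the set of those $[a:b]\in\mathbb P^1$ for which the pullback of $M$ along $t\mapsto ax+by$ is not free over $k[t]/t^2$. Two group scheme structures $G,G'$ on $A$, with tensor products $\otimes,\otimes'$, are in noble correspondence if $M\otimes N\cong M\otimes'N$ whenever $\mathfrak p\in\mathbb P^1$ is noble for both $G$ and $G'$ and $M,N$ are finite-dimensional $A$-modules with support $\{\mathfrak p\}$. Then: 1. (Bašev–Conlon formula for the noble square) If $G\in\{\widetilde G,G_1,G_2,G_3\}$ and $\mathfrak p\in\mathbb P^1$ is noble for $G$, then for all $n$ and for every choice of $a,b,c,d$ as above, $$V_{2n}(\mathfrak p)\otimes V_{2n}(\mathfrak p)\;\cong\;2V_{2n}(\mathfrak p)\oplus(n^2-n)P,$$ where $\otimes$ is the tensor product for $G$. 2. $\widetilde G$ is in noble correspondence with each of $G_1,G_2,G_3$. 3. $\widetilde G$ has Property PA: every $\mathfrak p\in\mathbb P^1$ is noble for $\widetilde G$, and $\widetilde G$ is in noble correspondence with every group scheme structure on the augmented algebra $A$. -/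

import Mathlib

open scoped TensorProduct LinearAlgebra.Projectivization DualNumber

universe u v

noncomputable section

namespace NobleSquare

/-! ### Finite-dimensional algebras and their representations

A module over a `k`-algebra `A` on the `k`-vector space `V` is given by its structure map
`A →ₐ[k] Module.End k V`. -/

section Representations

variable {k : Type*} [Field k] {A : Type*} [Ring A] [Algebra k A]

/-- Two `A`-modules are isomorphic: there is an `A`-linear bijection between them. -/
def RepIso {V W : Type*} [AddCommGroup V] [Module k V] [AddCommGroup W] [Module k W]
    (ρ : A →ₐ[k] Module.End k V) (σ : A →ₐ[k] Module.End k W) : Prop :=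
  ∃ e : V ≃ₗ[k] W, ∀ (a : A) (x : V), e (ρ a x) = σ a (e x)

/-- The direct sum `V ⊕ W` of two `A`-modules. -/
def repSum {V W : Type*} [AddCommGroup V] [Module k V] [AddCommGroup W] [Module k W]
    (ρ : A →ₐ[k] Module.End k V) (σ : A →ₐ[k] Module.End k W) :
    A →ₐ[k] Module.End k (V × W) where
  toFun a := (ρ a).prodMap (σ a)
  map_one' := by ext <;> simp
  map_mul' a b := by ext <;> simp
  map_zero' := by ext <;> simp
  map_add' a b := by ext <;> simp
  commutes' c := by ext <;> simp [Module.algebraMap_end_apply]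

/-- The direct sum `m V` of `m` copies of an `A`-module `V`. -/
def repMul (m : ℕ) {V : Type*} [AddCommGroup V] [Module k V] (ρ : A →ₐ[k] Module.End k V) :
    A →ₐ[k] Module.End k (Fin m → V) where
  toFun a := LinearMap.pi fun i => (ρ a).comp (LinearMap.proj i)
  map_one' := by ext; simp
  map_mul' a b := by ext; simp
  map_zero' := by ext; simp
  map_add' a b := by ext; simp
  commutes' c := by ext; simp [Module.algebraMap_end_apply]

variable (k A) in
/-- The regular representation: `A` as a left module over itself. -/
def regularRep : A →ₐ[k] Module.End k A := Algebra.lmul k A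

/-- The pullback of the `A`-module `ρ` along `α : k[t]/t² → A` is a free `k[t]/t²`-module. -/
def IsFreeAlong {V : Type*} [AddCommGroup V] [Module k V] (α : k[ε] →ₐ[k] A)
    (ρ : A →ₐ[k] Module.End k V) : Prop :=
  letI : Module k[ε] V := Module.compHom V (ρ.comp α).toRingHom
  Module.Free k[ε] V

end Representations

/-! ### Cohomology of an augmented algebra

`H^*(A, k) = Ext_A^*(k, k)` is computed by the complex of multilinear cochains `A^n → k` with the
Hochschild differential for the trivial coefficients `k`; the product is concatenation. -/

section Cohomology

variable {k : Type*} [Field k] {A : Type*} [Ring A] [Algebra k A]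

variable (k A) in
/-- Multilinear cochains of degree `n`. -/
abbrev Cochain (n : ℕ) : Type _ := MultilinearMap k (fun _ : Fin n => A) k

/-- `(df)(a₀, …, aₙ) = ε(a₀) f(a₁, …, aₙ) + ∑_{j < n} (-1)^(j+1) f(…, aⱼ aⱼ₊₁, …)
+ (-1)^(n+1) f(a₀, …, aₙ₋₁) ε(aₙ)`. -/
def coboundary (aug : A →ₐ[k] k) {n : ℕ} (f : Cochain k A n) (a : Fin (n + 1) → A) : k :=
  aug (a 0) * f (Fin.tail a)
    + ∑ j : Fin n, (-1) ^ ((j : ℕ) + 1) * f (Fin.contractNth j.castSucc (· * ·) a)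
    + (-1) ^ (n + 1) * (f (Fin.init a) * aug (a (Fin.last n)))

/-- `f` is a cocycle. -/
def IsCocycle (aug : A →ₐ[k] k) {n : ℕ} (f : Cochain k A n) : Prop :=
  ∀ a, coboundary aug f a = 0

/-- A function of `n` arguments is the coboundary of a cochain of degree `n - 1`
(in degree `0`, the only one is `0`). -/
def IsCoboundary (aug : A →ₐ[k] k) : (n : ℕ) → ((Fin n → A) → k) → Prop
  | 0, g => ∀ a, g a = 0
  | n + 1, g => ∃ f : Cochain k A n, ∀ a, g a = coboundary aug f a

/-- The `m`-fold product of `f` with itself, a function of `m * n` arguments: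
`f(a₀, …, aₙ₋₁) f(aₙ, …, a₂ₙ₋₁) ⋯`. -/
def cupPow {n : ℕ} (f : (Fin n → A) → k) (m : ℕ) (a : Fin (m * n) → A) : k :=
  ∏ i : Fin m, f fun j => a (finProdFinEquiv (i, j))

/-- The augmentation `k[t]/t² → k`, `t ↦ 0`. -/
def dualAug (k : Type*) [Field k] : k[ε] →ₐ[k] k := TrivSqZeroExt.fstHom k k k

/-- The point `𝔭(α)` of `Proj H^*(A, k)` for `α : k[t]/t² → A`, i.e. the radical of the kernel of
`H^*(α) : H^*(A, k) → H^*(k[t]/t², k)`, as the set of its homogeneous elements, each of them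
represented by all of its cocycles. (In characteristic `2` the whole of `H^*(A, k)` is
commutative.) -/
def pointOf (aug : A →ₐ[k] k) (α : k[ε] →ₐ[k] A) : Set (Σ n : ℕ, Cochain k A n) :=
  {f | IsCocycle aug f.2 ∧
    ∃ m : ℕ, 0 < m ∧
      IsCoboundary (dualAug k) (m * f.1) (cupPow (fun b : Fin f.1 → k[ε] => f.2 (α ∘ b)) m)}

end Cohomology

/-! ### Group scheme structures on a commutative augmented algebra -/

/-- A group scheme structure `(Δ, S)` on the augmented algebra `A`: a coassociative, cocommutative
algebra map `Δ : A → A ⊗ A` with counit the given augmentation and with antipode `S`. -/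
@[ext] structure GroupStructure {k : Type*} [Field k] {A : Type*} [CommRing A] [Algebra k A]
    (aug : A →ₐ[k] k) where
  /-- the comultiplication `Δ` -/
  comul : A →ₐ[k] A ⊗[k] A
  /-- the antipode `S` -/
  antipode : A →ₗ[k] A
  coassoc : (Algebra.TensorProduct.assoc k k k A A A).toAlgHom.comp
      ((Algebra.TensorProduct.map comul (AlgHom.id k A)).comp comul) =
    (Algebra.TensorProduct.map (AlgHom.id k A) comul).comp comul
  cocomm : (Algebra.TensorProduct.comm k A A).toAlgHom.comp comul = comul
  counit_left : (Algebra.TensorProduct.lid k A).toAlgHom.comp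
    ((Algebra.TensorProduct.map aug (AlgHom.id k A)).comp comul) = AlgHom.id k A
  counit_right : (Algebra.TensorProduct.rid k k A).toAlgHom.comp
    ((Algebra.TensorProduct.map (AlgHom.id k A) aug).comp comul) = AlgHom.id k A
  antipode_left : ∀ a, LinearMap.mul' k A (TensorProduct.map antipode LinearMap.id (comul a)) =
    algebraMap k A (aug a)
  antipode_right : ∀ a, LinearMap.mul' k A (TensorProduct.map LinearMap.id antipode (comul a)) =
    algebraMap k A (aug a)

namespace GroupStructure

variable {k : Type*} [Field k] {A : Type*} [CommRing A] [Algebra k A] {aug : A →ₐ[k] k}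

/-- The tensor product `V ⊗ W` of `A`-modules: the `A ⊗ A`-module `V ⊗ W` pulled back along the
comultiplication. -/
def tensor (G : GroupStructure aug) {V W : Type*} [AddCommGroup V] [Module k V]
    [AddCommGroup W] [Module k W] (ρ : A →ₐ[k] Module.End k V) (σ : A →ₐ[k] Module.End k W) :
    A →ₐ[k] Module.End k (V ⊗[k] W) :=
  (Module.endTensorEndAlgHom (R := k) (S := k) (A := k) (M := V) (N := W)).comp
    ((Algebra.TensorProduct.map ρ σ).comp G.comul)

/-- The subalgebra `U` of `A = kG` is the group algebra of a subgroup scheme of `G`, i.e. it is a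
Hopf subalgebra. -/
def IsSubgroup (G : GroupStructure aug) (U : Subalgebra k A) : Prop :=
  (∀ a ∈ U, G.comul a ∈ (Algebra.TensorProduct.map U.val U.val).range) ∧
    ∀ a ∈ U, G.antipode a ∈ U

/-- `α : k[t]/t² → kG` is a `π`-point of `G`: it is flat and factors through the group algebra of a
unipotent (i.e. with local group algebra) abelian subgroup scheme. -/
def IsPiPoint (G : GroupStructure aug) (α : k[ε] →ₐ[k] A) : Prop :=
  α.toRingHom.Flat ∧
    ∃ U : Subalgebra k A, G.IsSubgroup U ∧ IsLocalRing U ∧ (∀ a ∈ U, ∀ b ∈ U, a * b = b * a) ∧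
      α.range ≤ U

/-- The point `𝔭(β)` is noble for `G`: there are a subgroup scheme `C < G` and an isomorphism
`k[t]/t² ≅ kC` such that the inclusion `α : k[t]/t² ≅ kC → kG` is a `π`-point with
`𝔭(α) = 𝔭(β)`. -/
def IsNobleAt (G : GroupStructure aug) (β : k[ε] →ₐ[k] A) : Prop :=
  ∃ (C : Subalgebra k A) (e : k[ε] ≃ₐ[k] C), G.IsSubgroup C ∧
    G.IsPiPoint (C.val.comp e.toAlgHom) ∧
    pointOf aug (C.val.comp e.toAlgHom) = pointOf aug β

end GroupStructure

/-! ### The algebra `A = k[x, y]/(x², y²)` -/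

section Kronecker

variable (k : Type u) [Field k]

/-- The ideal `(x², y²)`. -/
def kroneckerIdeal : Ideal (MvPolynomial (Fin 2) k) :=
  Ideal.span {MvPolynomial.X 0 ^ 2, MvPolynomial.X 1 ^ 2}

/-- `A = k[x, y]/(x², y²)`. -/
def KAlg : Type u := MvPolynomial (Fin 2) k ⧸ kroneckerIdeal k

namespace KAlg

instance : CommRing (KAlg k) := inferInstanceAs (CommRing (MvPolynomial (Fin 2) k ⧸ kroneckerIdeal k))

instance : Algebra k (KAlg k) :=
  inferInstanceAs (Algebra k (MvPolynomial (Fin 2) k ⧸ kroneckerIdeal k))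

/-- The quotient map `k[x, y] → A`. -/
def mk : MvPolynomial (Fin 2) k →ₐ[k] KAlg k := Ideal.Quotient.mkₐ k (kroneckerIdeal k)

theorem mk_eq_zero {f : MvPolynomial (Fin 2) k} (hf : f ∈ kroneckerIdeal k) : mk k f = 0 :=
  Ideal.Quotient.eq_zero_iff_mem.2 hf

/-- The generator `x`. -/
def x : KAlg k := mk k (MvPolynomial.X 0)

/-- The generator `y`. -/
def y : KAlg k := mk k (MvPolynomial.X 1)

theorem x_mul_x : x k * x k = 0 := by
  rw [x, ← map_mul, ← pow_two]
  exact mk_eq_zero k (Ideal.subset_span (by simp))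

theorem y_mul_y : y k * y k = 0 := by
  rw [y, ← map_mul, ← pow_two]
  exact mk_eq_zero k (Ideal.subset_span (by simp))

variable {k}

/-- Two algebra maps on `A` that agree on `x` and `y` are equal. -/
theorem algHom_ext {B : Type*} [Semiring B] [Algebra k B] {f g : KAlg k →ₐ[k] B}
    (hx : f (x k) = g (x k)) (hy : f (y k) = g (y k)) : f = g := by
  apply Ideal.Quotient.algHom_ext
  apply MvPolynomial.algHom_ext
  intro i
  fin_cases i
  · exact hx
  · exact hy

/-- The algebra map to a commutative algebra `x ↦ X`, `y ↦ Y`, for `X² = Y² = 0`. -/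
def lift {B : Type*} [CommRing B] [Algebra k B] (X Y : B) (hX : X * X = 0) (hY : Y * Y = 0) :
    KAlg k →ₐ[k] B :=
  Ideal.Quotient.liftₐ (kroneckerIdeal k) (MvPolynomial.aeval ![X, Y]) (by
    intro a ha
    have h : kroneckerIdeal k ≤ RingHom.ker (MvPolynomial.aeval (R := k) ![X, Y]) := by
      rw [kroneckerIdeal, Ideal.span_le]
      rintro b (rfl | rfl)
      · simp [RingHom.mem_ker, pow_two, hX]
      · simp [RingHom.mem_ker, pow_two, hY]
    exact h ha)

@[simp] theorem lift_x {B : Type*} [CommRing B] [Algebra k B] (X Y : B) (hX : X * X = 0)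
    (hY : Y * Y = 0) : lift (k := k) X Y hX hY (x k) = X := by
  have h : lift (k := k) X Y hX hY (x k) =
      MvPolynomial.aeval (R := k) ![X, Y] (MvPolynomial.X 0) := rfl
  rw [h]
  simp

@[simp] theorem lift_y {B : Type*} [CommRing B] [Algebra k B] (X Y : B) (hX : X * X = 0)
    (hY : Y * Y = 0) : lift (k := k) X Y hX hY (y k) = Y := by
  have h : lift (k := k) X Y hX hY (y k) =
      MvPolynomial.aeval (R := k) ![X, Y] (MvPolynomial.X 1) := rfl
  rw [h]
  simp

variable (k)

/-- The augmentation `x, y ↦ 0`. -/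
def aug : KAlg k →ₐ[k] k := lift 0 0 (by simp) (by simp)

@[simp] theorem aug_x : aug k (x k) = 0 := by simp [aug]

@[simp] theorem aug_y : aug k (y k) = 0 := by simp [aug]

end KAlg

open KAlg

variable {k}

theorem add_self_eq_zero' [CharP k 2] {M : Type*} [AddCommGroup M] [Module k M] (z : M) :
    z + z = 0 := by
  rw [← two_smul k z, CharTwo.two_eq_zero, zero_smul]

/-- The `π`-point `t ↦ v₀ x + v₁ y`. -/
def linearPoint [CharP k 2] (v : Fin 2 → k) : k[ε] →ₐ[k] KAlg k :=
  DualNumber.lift ⟨(Algebra.ofId k (KAlg k), v 0 • x k + v 1 • y k), by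
    constructor
    · have h := add_self_eq_zero' (k := k) ((v 0 * v 1) • (x k * y k))
      simp only [add_mul, mul_add, smul_mul_smul_comm, x_mul_x, y_mul_y, smul_zero, zero_add,
        add_zero]
      rw [mul_comm (y k), mul_comm (v 1)]
      exact h
    · intro a
      exact Commute.all _ _⟩

@[simp] theorem linearPoint_eps [CharP k 2] (v : Fin 2 → k) :
    linearPoint v (DualNumber.eps : k[ε]) = v 0 • x k + v 1 • y k := by
  simp [linearPoint]

/-! ### Points, support and the modules `V_{2n}(𝔭)` -/

/-- A closed point `𝔭 = [a : b]` of `ℙ¹ = Proj H^*(A, k)`, i.e. `𝔭 = 𝔭(α)` for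
`α : t ↦ a x + b y`, is noble for `G`. -/
def IsNoble [CharP k 2] (G : GroupStructure (aug k)) (p : ℙ k (Fin 2 → k)) : Prop :=
  G.IsNobleAt (linearPoint p.rep)

/-- The support of the `A`-module `V`: the set of those `[a : b]` for which the pullback of `V`
along `t ↦ a x + b y` is not free over `k[t]/t²`. -/
def support [CharP k 2] {V : Type*} [AddCommGroup V] [Module k V]
    (ρ : KAlg k →ₐ[k] Module.End k V) : Set (ℙ k (Fin 2 → k)) :=
  {p | ¬ IsFreeAlong (linearPoint p.rep) ρ}

/-- The endomorphism of `k^n ⊕ k^n` (lower and upper blocks) with matrix `(0 T; 0 0)`. -/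
def block (n : ℕ) : Matrix (Fin n) (Fin n) k →ₗ[k] Module.End k ((Fin n → k) × (Fin n → k)) where
  toFun T := (LinearMap.inl k _ _).comp ((Matrix.toLin' T).comp (LinearMap.snd k _ _))
  map_add' S T := by ext <;> simp
  map_smul' c T := by ext <;> simp

@[simp] theorem block_apply (n : ℕ) (T : Matrix (Fin n) (Fin n) k)
    (m : (Fin n → k) × (Fin n → k)) : block n T m = (T.mulVec m.2, 0) := by
  simp [block]

/-- The `A`-module `k^n ⊕ k^n` on which `x` and `y` act by `(0 X; 0 0)` and `(0 Y; 0 0)`. -/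
def blockRep (n : ℕ) (X Y : Matrix (Fin n) (Fin n) k) :
    KAlg k →ₐ[k] Module.End k ((Fin n → k) × (Fin n → k)) :=
  (TrivSqZeroExt.lift (Algebra.ofId k _) (block n)
    (fun S T => by ext <;> simp)
    (fun r T => by
      rw [map_smul, Algebra.ofId_apply, Algebra.smul_def])
    (fun r T => by
      rw [op_smul_eq_smul, map_smul, Algebra.ofId_apply, Algebra.smul_def, Algebra.commutes])).comp
  (lift (k := k) (TrivSqZeroExt.inr X : TrivSqZeroExt k (Matrix (Fin n) (Fin n) k))
    (TrivSqZeroExt.inr Y) (by simp) (by simp))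

@[simp] theorem blockRep_x (n : ℕ) (X Y : Matrix (Fin n) (Fin n) k) :
    blockRep n X Y (x k) = block n X := by
  simp [blockRep]

@[simp] theorem blockRep_y (n : ℕ) (X Y : Matrix (Fin n) (Fin n) k) :
    blockRep n X Y (y k) = block n Y := by
  simp [blockRep]

/-- The `n × n` upper triangular nilpotent Jordan block. -/
def jordan (k : Type*) [Field k] (n : ℕ) : Matrix (Fin n) (Fin n) k :=
  Matrix.of fun i j => if (i : ℕ) + 1 = j then 1 else 0

/-- The module `V_{2n}(𝔭)`, `𝔭 = [v₀ : v₁]`, formed with the basis `s₂ = v₀ x + v₁ y`,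
`s₁ = w₀ x + w₁ y` of `⟨x, y⟩`: here `s₁` acts by `(0 I; 0 0)` and `s₂` by `(0 N; 0 0)`, with `N`
the nilpotent Jordan block; `x` and `y` are solved for in terms of `s₁` and `s₂`. -/
def V (n : ℕ) (v w : Fin 2 → k) : KAlg k →ₐ[k] Module.End k ((Fin n → k) × (Fin n → k)) :=
  blockRep n ((v 0 * w 1 - v 1 * w 0)⁻¹ • (w 1 • jordan k n - v 1 • 1))
    ((v 0 * w 1 - v 1 * w 0)⁻¹ • (v 0 • 1 - w 0 • jordan k n))

theorem det_ne_zero {v w : Fin 2 → k} (h : LinearIndependent k ![v, w]) :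
    v 0 * w 1 - v 1 * w 0 ≠ 0 := by
  have h' : LinearIndependent k (Matrix.of ![v, w]).row := h
  rw [Matrix.linearIndependent_rows_iff_isUnit, Matrix.isUnit_iff_isUnit_det,
    Matrix.det_fin_two] at h'
  simpa using h'.ne_zero

theorem V_s₁ (n : ℕ) {v w : Fin 2 → k} (h : LinearIndependent k ![v, w]) :
    V n v w (w 0 • x k + w 1 • y k) = block n 1 := by
  have hd := det_ne_zero h
  rw [map_add, map_smul, map_smul, V, blockRep_x, blockRep_y, ← map_smul, ← map_smul, ← map_add]
  congr 1
  ext i j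
  simp only [Matrix.add_apply, Matrix.smul_apply, Matrix.sub_apply, smul_eq_mul]
  linear_combination (1 : Matrix (Fin n) (Fin n) k) i j * inv_mul_cancel₀ hd

theorem V_s₂ (n : ℕ) {v w : Fin 2 → k} (h : LinearIndependent k ![v, w]) :
    V n v w (v 0 • x k + v 1 • y k) = block n (jordan k n) := by
  have hd := det_ne_zero h
  rw [map_add, map_smul, map_smul, V, blockRep_x, blockRep_y, ← map_smul, ← map_smul, ← map_add]
  congr 1
  ext i j
  simp only [Matrix.add_apply, Matrix.smul_apply, Matrix.sub_apply, smul_eq_mul]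
  linear_combination jordan k n i j * inv_mul_cancel₀ hd

/-! ### Noble correspondence and Property PA -/

/-- `G` and `G'` are in noble correspondence: for each closed point `𝔭` that is noble for both,
`M ⊗ N ≅ M ⊗' N` for all finite modules `M`, `N` with support `{𝔭}`. -/
def NobleCorrespondence [CharP k 2] (G G' : GroupStructure (aug k)) : Prop :=
  ∀ p : ℙ k (Fin 2 → k), IsNoble G p → IsNoble G' p →
    ∀ (M N : Type v) [AddCommGroup M] [Module k M] [FiniteDimensional k M]
      [AddCommGroup N] [Module k N] [FiniteDimensional k N]
      (ρ : KAlg k →ₐ[k] Module.End k M) (σ : KAlg k →ₐ[k] Module.End k N),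
      support ρ = {p} → support σ = {p} → RepIso (G.tensor ρ σ) (G'.tensor ρ σ)

/-- `G` has Property PA: every closed point is noble for `G`, and `G` is in noble correspondence
with every group scheme structure on the augmented algebra `A`. -/
def PropertyPA [CharP k 2] (G : GroupStructure (aug k)) : Prop :=
  (∀ p : ℙ k (Fin 2 → k), IsNoble G p) ∧
    ∀ G' : GroupStructure (aug k), NobleCorrespondence.{u, v} G G'

/-! ### The four group scheme structures -/

/-- An algebra map `Δ : A → A ⊗ A` is a group scheme structure with the identity as antipode, if the
laws hold on the generators `x` and `y`. -/
def mkGroup (D : KAlg k →ₐ[k] KAlg k ⊗[k] KAlg k)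
    (assoc : ∀ z ∈ ({x k, y k} : Set (KAlg k)),
      Algebra.TensorProduct.assoc k k k (KAlg k) (KAlg k) (KAlg k)
        (Algebra.TensorProduct.map D (AlgHom.id k (KAlg k)) (D z)) =
      Algebra.TensorProduct.map (AlgHom.id k (KAlg k)) D (D z))
    (comm : ∀ z ∈ ({x k, y k} : Set (KAlg k)),
      Algebra.TensorProduct.comm k (KAlg k) (KAlg k) (D z) = D z)
    (left : ∀ z ∈ ({x k, y k} : Set (KAlg k)), Algebra.TensorProduct.lid k (KAlg k)
      (Algebra.TensorProduct.map (aug k) (AlgHom.id k (KAlg k)) (D z)) = z)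
    (right : ∀ z ∈ ({x k, y k} : Set (KAlg k)), Algebra.TensorProduct.rid k k (KAlg k)
      (Algebra.TensorProduct.map (AlgHom.id k (KAlg k)) (aug k) (D z)) = z)
    (mul : ∀ z ∈ ({x k, y k} : Set (KAlg k)), Algebra.TensorProduct.lmul' k (S := KAlg k) (D z) = 0) :
    GroupStructure (aug k) where
  comul := D
  antipode := LinearMap.id
  coassoc := algHom_ext (assoc _ (by simp)) (assoc _ (by simp))
  cocomm := algHom_ext (comm _ (by simp)) (comm _ (by simp))
  counit_left := algHom_ext (left _ (by simp)) (left _ (by simp))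
  counit_right := algHom_ext (right _ (by simp)) (right _ (by simp))
  antipode_left := by
    have h : (Algebra.TensorProduct.lmul' k (S := KAlg k)).comp D =
        (Algebra.ofId k (KAlg k)).comp (aug k) :=
      algHom_ext (by simpa using mul (x k) (by simp)) (by simpa using mul (y k) (by simp))
    intro a
    rw [TensorProduct.map_id]
    exact DFunLike.congr_fun h a
  antipode_right := by
    have h : (Algebra.TensorProduct.lmul' k (S := KAlg k)).comp D =
        (Algebra.ofId k (KAlg k)).comp (aug k) :=
      algHom_ext (by simpa using mul (x k) (by simp)) (by simpa using mul (y k) (by simp))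
    intro a
    rw [TensorProduct.map_id]
    exact DFunLike.congr_fun h a

variable (k)
variable [CharP k 2]

/-- `x ⊗ 1 + 1 ⊗ x` and the like. -/
def prim (z : KAlg k) : KAlg k ⊗[k] KAlg k := z ⊗ₜ[k] 1 + 1 ⊗ₜ[k] z

variable {k}

theorem sq_aux {z w : KAlg k} (hz : z * z = 0) (hw : w * w = 0) :
    (prim k z + w ⊗ₜ[k] w) * (prim k z + w ⊗ₜ[k] w) = 0 := by
  have e : (prim k z + w ⊗ₜ[k] w) * (prim k z + w ⊗ₜ[k] w) =
      (z ⊗ₜ[k] z + (z * w) ⊗ₜ[k] w + w ⊗ₜ[k] (z * w)) +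
        (z ⊗ₜ[k] z + (z * w) ⊗ₜ[k] w + w ⊗ₜ[k] (z * w)) := by
    simp only [prim, add_mul, mul_add, Algebra.TensorProduct.tmul_mul_tmul, hz, hw, mul_one,
      one_mul, TensorProduct.zero_tmul, TensorProduct.tmul_zero, mul_comm w z]
    abel
  rw [e, add_self_eq_zero' (k := k)]

theorem sq_prim {z : KAlg k} (hz : z * z = 0) : prim k z * prim k z = 0 := by
  simpa using sq_aux hz (w := 0) (by simp)

variable (k)

set_option linter.unusedSimpArgs false

/-- `G̃ = 𝔾_{a(1)}²`: `Δ(x) = x ⊗ 1 + 1 ⊗ x`, `Δ(y) = y ⊗ 1 + 1 ⊗ y`. -/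
def G₀ : GroupStructure (aug k) := by
  refine mkGroup (lift (prim k (x k)) (prim k (y k))
    (sq_prim (x_mul_x k)) (sq_prim (y_mul_y k))) ?_ ?_ ?_ ?_ ?_ <;>
    rintro z (rfl | rfl)
  all_goals first
    | (simp [prim, TensorProduct.add_tmul, TensorProduct.tmul_add, add_self_eq_zero' (k := k),
        Algebra.TensorProduct.one_def]; done)
    | (simp [prim, TensorProduct.add_tmul, TensorProduct.tmul_add, add_self_eq_zero' (k := k),
        Algebra.TensorProduct.one_def, add_comm, x_mul_x, y_mul_y]; done)
    | (simp [prim, TensorProduct.add_tmul, TensorProduct.tmul_add, add_self_eq_zero' (k := k),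
        Algebra.TensorProduct.one_def]; abel)

/-- `G₁ = 𝔾_{a(2)}`: `Δ(x) = x ⊗ 1 + 1 ⊗ x`, `Δ(y) = y ⊗ 1 + 1 ⊗ y + ω(x)`, where `ω(x) = x ⊗ x`
in characteristic `2`. -/
def G₁ : GroupStructure (aug k) := by
  refine mkGroup (lift (prim k (x k)) (prim k (y k) + x k ⊗ₜ[k] x k)
    (sq_prim (x_mul_x k)) (sq_aux (y_mul_y k) (x_mul_x k))) ?_ ?_ ?_ ?_ ?_ <;>
    rintro z (rfl | rfl)
  all_goals first
    | (simp [prim, TensorProduct.add_tmul, TensorProduct.tmul_add, add_self_eq_zero' (k := k),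
        Algebra.TensorProduct.one_def]; done)
    | (simp [prim, TensorProduct.add_tmul, TensorProduct.tmul_add, add_self_eq_zero' (k := k),
        Algebra.TensorProduct.one_def, add_comm, x_mul_x, y_mul_y]; done)
    | (simp [prim, TensorProduct.add_tmul, TensorProduct.tmul_add, add_self_eq_zero' (k := k),
        Algebra.TensorProduct.one_def]; abel)

/-- `G₂ = 𝔾_{a(1)} × ℤ/2`: `Δ(x) = x ⊗ 1 + 1 ⊗ x`, `Δ(y) = y ⊗ 1 + 1 ⊗ y + y ⊗ y`. -/
def G₂ : GroupStructure (aug k) := by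
  refine mkGroup (lift (prim k (x k)) (prim k (y k) + y k ⊗ₜ[k] y k)
    (sq_prim (x_mul_x k)) (sq_aux (y_mul_y k) (y_mul_y k))) ?_ ?_ ?_ ?_ ?_ <;>
    rintro z (rfl | rfl)
  all_goals first
    | (simp [prim, TensorProduct.add_tmul, TensorProduct.tmul_add, add_self_eq_zero' (k := k),
        Algebra.TensorProduct.one_def]; done)
    | (simp [prim, TensorProduct.add_tmul, TensorProduct.tmul_add, add_self_eq_zero' (k := k),
        Algebra.TensorProduct.one_def, add_comm, x_mul_x, y_mul_y]; done)
    | (simp [prim, TensorProduct.add_tmul, TensorProduct.tmul_add, add_self_eq_zero' (k := k),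
        Algebra.TensorProduct.one_def]; abel)

/-- `G₃ = (ℤ/2)²`: `Δ(x) = x ⊗ 1 + 1 ⊗ x + x ⊗ x`, `Δ(y) = y ⊗ 1 + 1 ⊗ y + y ⊗ y`. -/
def G₃ : GroupStructure (aug k) := by
  refine mkGroup (lift (prim k (x k) + x k ⊗ₜ[k] x k) (prim k (y k) + y k ⊗ₜ[k] y k)
    (sq_aux (x_mul_x k) (x_mul_x k)) (sq_aux (y_mul_y k) (y_mul_y k))) ?_ ?_ ?_ ?_ ?_ <;>
    rintro z (rfl | rfl)
  all_goals first
    | (simp [prim, TensorProduct.add_tmul, TensorProduct.tmul_add, add_self_eq_zero' (k := k),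
        Algebra.TensorProduct.one_def]; done)
    | (simp [prim, TensorProduct.add_tmul, TensorProduct.tmul_add, add_self_eq_zero' (k := k),
        Algebra.TensorProduct.one_def, add_comm, x_mul_x, y_mul_y]; done)
    | (simp [prim, TensorProduct.add_tmul, TensorProduct.tmul_add, add_self_eq_zero' (k := k),
        Algebra.TensorProduct.one_def]; abel)

theorem G₀_x : (G₀ k).comul (x k) = x k ⊗ₜ[k] 1 + 1 ⊗ₜ[k] x k :=
  lift_x _ _ (sq_prim (x_mul_x k)) (sq_prim (y_mul_y k))

theorem G₀_y : (G₀ k).comul (y k) = y k ⊗ₜ[k] 1 + 1 ⊗ₜ[k] y k :=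
  lift_y _ _ (sq_prim (x_mul_x k)) (sq_prim (y_mul_y k))

theorem G₁_x : (G₁ k).comul (x k) = x k ⊗ₜ[k] 1 + 1 ⊗ₜ[k] x k :=
  lift_x _ _ (sq_prim (x_mul_x k)) (sq_aux (y_mul_y k) (x_mul_x k))

theorem G₁_y : (G₁ k).comul (y k) = y k ⊗ₜ[k] 1 + 1 ⊗ₜ[k] y k + x k ⊗ₜ[k] x k :=
  lift_y _ _ (sq_prim (x_mul_x k)) (sq_aux (y_mul_y k) (x_mul_x k))

theorem G₂_x : (G₂ k).comul (x k) = x k ⊗ₜ[k] 1 + 1 ⊗ₜ[k] x k :=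
  lift_x _ _ (sq_prim (x_mul_x k)) (sq_aux (y_mul_y k) (y_mul_y k))

theorem G₂_y : (G₂ k).comul (y k) = y k ⊗ₜ[k] 1 + 1 ⊗ₜ[k] y k + y k ⊗ₜ[k] y k :=
  lift_y _ _ (sq_prim (x_mul_x k)) (sq_aux (y_mul_y k) (y_mul_y k))

theorem G₃_x : (G₃ k).comul (x k) = x k ⊗ₜ[k] 1 + 1 ⊗ₜ[k] x k + x k ⊗ₜ[k] x k :=
  lift_x _ _ (sq_aux (x_mul_x k) (x_mul_x k)) (sq_aux (y_mul_y k) (y_mul_y k))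

theorem G₃_y : (G₃ k).comul (y k) = y k ⊗ₜ[k] 1 + 1 ⊗ₜ[k] y k + y k ⊗ₜ[k] y k :=
  lift_y _ _ (sq_aux (x_mul_x k) (x_mul_x k)) (sq_aux (y_mul_y k) (y_mul_y k))

end Kronecker

end NobleSquare

end

/-!
All three parts compare a structure `G` with `G₀`, for which `Δ(z) = z ⊗ 1 + 1 ⊗ z` on the linear
elements `z = lin v = v₀ x + v₁ y`; these elements show that every point is noble for `G₀`
(`isNobleAt_G₀`). If `𝔭 = [v]` is noble for `G`, then classes of degree one already show that the
corresponding subgroup scheme has group algebra `k[S]/S²` with `S = lin v + d xy`, so that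
`Δ(S) = S ⊗ 1 + 1 ⊗ S + c S ⊗ S` (`exists_of_isNobleAt`). This shape of `Δ(S)` is all that is used
about `𝔭` being noble, and it gives `M ⊗_G N ≅ M ⊗_{G₀} N` for `M`, `N` supported at `𝔭`:

* For every structure `A ⊗ N` is isomorphic to `A ⊗ N` with `A` acting on the first factor only
  (`regular_tensor`), and since `A` is self-injective, free summands can be split off
  (`exists_split`). So `M` and `N` may be assumed to be killed by `xy`.
* Let `s = lin v` and let `r = lin w` be another linear element. As the support is `{𝔭}`, `M` is
  free over `k[r]`, hence `M = W ⊕ rW`, and `s = r n` for a nilpotent operator `n` on `W`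
  (`exists_blockOps`). A nilpotent `n` has a grading operator `h`, with `[h, n] = n`
  (`exists_grading`).
* On `M ⊗ N`, with indices for the two factors, `G₀` lets `r` and `s` act by `r₁ + r₂` and
  `r₁n₁ + r₂n₂`. For `G` there are the additional terms `θ r₁r₂` and
  `(c n₁n₂ - d'(n₁ + n₂)) r₁r₂`. The second one has no constant term, because `𝔭` is noble, and
  then both are removed by the unipotent operator `1 + twist` built from `h₂` and the projections
  onto the images of `r₁` and `r₂` (`TwistData.twist_mul_sum`, `TwistData.twist_mul_nilp`,
  `BlockOps.repIso_tensor`).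

For the square of `V_{2n}` it remains to decompose the tensor product for `G₀`. On the
`n²`-dimensional space `k^n ⊗ k^n` the operator `D = n₁ + n₂` has kernel and cokernel of dimension
`n`, on both of which `n₁` is a Jordan block; these give the two copies of `V_{2n}`, and a complement
of the kernel of `D` generates a free module of rank `n² - n` (`square_G₀`).
-/


namespace NobleSquare

/-! ### Isomorphisms of representations and tensor products -/

section RepIso

variable {k : Type*} [Field k] {A : Type*} [Ring A] [Algebra k A]
  {V W V' W' U : Type*} [AddCommGroup V] [Module k V] [AddCommGroup W] [Module k W]
  [AddCommGroup V'] [Module k V'] [AddCommGroup W'] [Module k W'] [AddCommGroup U] [Module k U]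

theorem RepIso.refl (ρ : A →ₐ[k] Module.End k V) : RepIso ρ ρ :=
  ⟨LinearEquiv.refl k V, fun _ _ => rfl⟩

theorem RepIso.symm {ρ : A →ₐ[k] Module.End k V} {σ : A →ₐ[k] Module.End k W}
    (h : RepIso ρ σ) : RepIso σ ρ := by
  obtain ⟨e, he⟩ := h
  refine ⟨e.symm, fun a x => ?_⟩
  rw [LinearEquiv.symm_apply_eq, he, LinearEquiv.apply_symm_apply]

theorem RepIso.trans {ρ : A →ₐ[k] Module.End k V} {σ : A →ₐ[k] Module.End k W}
    {τ : A →ₐ[k] Module.End k U} (h : RepIso ρ σ) (h' : RepIso σ τ) : RepIso ρ τ := by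
  obtain ⟨e, he⟩ := h
  obtain ⟨f, hf⟩ := h'
  exact ⟨e.trans f, fun a x => by simp [he, hf]⟩

theorem RepIso.sum {ρ : A →ₐ[k] Module.End k V} {σ : A →ₐ[k] Module.End k W}
    {ρ' : A →ₐ[k] Module.End k V'} {σ' : A →ₐ[k] Module.End k W'}
    (h : RepIso ρ ρ') (h' : RepIso σ σ') : RepIso (repSum ρ σ) (repSum ρ' σ') := by
  obtain ⟨e, he⟩ := h
  obtain ⟨f, hf⟩ := h'
  exact ⟨e.prodCongr f, fun a x => by simp [repSum, he, hf]⟩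

end RepIso

namespace GroupStructure

variable {k : Type*} [Field k] {A : Type*} [CommRing A] [Algebra k A] {aug : A →ₐ[k] k}
  (G : GroupStructure aug)
  {V W V' W' : Type*} [AddCommGroup V] [Module k V] [AddCommGroup W] [Module k W]
  [AddCommGroup V'] [Module k V'] [AddCommGroup W'] [Module k W']

/-- The action of `A ⊗ A` on `V ⊗ W`. -/
noncomputable def outer (ρ : A →ₐ[k] Module.End k V) (σ : A →ₐ[k] Module.End k W) :
    A ⊗[k] A →ₐ[k] Module.End k (V ⊗[k] W) :=
  (Module.endTensorEndAlgHom (R := k) (S := k) (A := k) (M := V) (N := W)).comp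
    (Algebra.TensorProduct.map ρ σ)

theorem outer_tmul (ρ : A →ₐ[k] Module.End k V) (σ : A →ₐ[k] Module.End k W) (a b : A) :
    outer ρ σ (a ⊗ₜ b) = TensorProduct.map (ρ a) (σ b) := rfl

theorem tensor_apply (ρ : A →ₐ[k] Module.End k V) (σ : A →ₐ[k] Module.End k W) (a : A) :
    G.tensor ρ σ a = outer ρ σ (G.comul a) := rfl

theorem tensor_congr {ρ : A →ₐ[k] Module.End k V} {σ : A →ₐ[k] Module.End k W}
    {ρ' : A →ₐ[k] Module.End k V'} {σ' : A →ₐ[k] Module.End k W'}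
    (h : RepIso ρ ρ') (h' : RepIso σ σ') : RepIso (G.tensor ρ σ) (G.tensor ρ' σ') := by
  obtain ⟨e, he⟩ := h
  obtain ⟨f, hf⟩ := h'
  refine ⟨TensorProduct.congr e f, fun a x => ?_⟩
  rw [tensor_apply, tensor_apply]
  generalize G.comul a = z
  induction z with
  | zero => simp
  | add y z hy hz => simp [hy, hz]
  | tmul a b =>
    rw [outer_tmul, outer_tmul]
    induction x with
    | zero => simp
    | add y z hy hz => simp only [map_add, hy, hz]
    | tmul x y => simp [he, hf]

theorem tensor_comm (ρ : A →ₐ[k] Module.End k V) (σ : A →ₐ[k] Module.End k W) :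
    RepIso (G.tensor ρ σ) (G.tensor σ ρ) := by
  refine ⟨TensorProduct.comm k V W, fun a x => ?_⟩
  have h : G.comul a = Algebra.TensorProduct.comm k A A (G.comul a) :=
    (DFunLike.congr_fun G.cocomm a).symm
  rw [tensor_apply, tensor_apply]
  rw [h]
  nth_rewrite 1 [← h]
  generalize G.comul a = z
  induction z with
  | zero => simp
  | add y z hy hz => simp [hy, hz]
  | tmul a b =>
    rw [Algebra.TensorProduct.comm_tmul, outer_tmul, outer_tmul]
    induction x with
    | zero => simp
    | add y z hy hz => simp only [map_add, hy, hz]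
    | tmul x y => simp

theorem tensor_sum_left (ρ : A →ₐ[k] Module.End k V) (ρ' : A →ₐ[k] Module.End k V')
    (σ : A →ₐ[k] Module.End k W) :
    RepIso (G.tensor (repSum ρ ρ') σ) (repSum (G.tensor ρ σ) (G.tensor ρ' σ)) := by
  refine ⟨TensorProduct.prodLeft k k V V' W, fun a x => ?_⟩
  have h : ∀ y, repSum (G.tensor ρ σ) (G.tensor ρ' σ) a y =
      (outer ρ σ (G.comul a) y.1, outer ρ' σ (G.comul a) y.2) := fun y => rfl
  rw [tensor_apply, h]
  generalize G.comul a = z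
  induction z with
  | zero => simp only [map_zero, LinearMap.zero_apply]; rfl
  | add y z hy hz => simp [hy, hz]
  | tmul a b =>
    simp only [outer_tmul]
    induction x with
    | zero => simp only [map_zero, Prod.fst_zero, Prod.snd_zero]; rfl
    | add y z hy hz => simp only [map_add, hy, hz, Prod.fst_add, Prod.snd_add, Prod.mk_add_mk]
    | tmul x y => obtain ⟨x, x'⟩ := x; simp [repSum]

/-- The action of `A` on the first factor of `V ⊗ W`. -/
noncomputable def leftRep (ρ : A →ₐ[k] Module.End k V) (W : Type*) [AddCommGroup W] [Module k W] :
    A →ₐ[k] Module.End k (V ⊗[k] W) :=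
  (Module.endTensorEndAlgHom (R := k) (S := k) (A := k) (M := V) (N := W)).comp
    (Algebra.TensorProduct.includeLeft.comp ρ)

theorem leftRep_apply (ρ : A →ₐ[k] Module.End k V) (a : A) :
    leftRep ρ W a = TensorProduct.map (ρ a) LinearMap.id := rfl

/-- The tensor identity: `A ⊗ W` is isomorphic to the free module `A ⊗ W` with `A` acting on the
first factor only, through `b ⊗ w ↦ Δ(b)(1 ⊗ w)`. Surjectivity comes from the antipode:
`b ⊗ w` is the image of `∑ b₁ ⊗ S(b₂) w`. -/
theorem regular_tensor [FiniteDimensional k A] [FiniteDimensional k W]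
    (σ : A →ₐ[k] Module.End k W) :
    RepIso (leftRep (regularRep k A) W) (G.tensor (regularRep k A) σ) := by
  let Θ : A ⊗[k] W →ₗ[k] A ⊗[k] W := TensorProduct.lift
    { toFun := fun b => (outer (regularRep k A) σ (G.comul b)).comp (TensorProduct.mk k A W 1)
      map_add' := fun b c => by ext; simp
      map_smul' := fun b c => by ext; simp }
  have hΘ : ∀ b w, Θ (b ⊗ₜ w) = outer (regularRep k A) σ (G.comul b) (1 ⊗ₜ w) := fun b w => rfl
  have surj : Function.Surjective Θ := by
    rw [← LinearMap.range_eq_top, eq_top_iff, ← TensorProduct.span_tmul_eq_top, Submodule.span_le]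
    rintro _ ⟨b, w, rfl⟩
    let ev : A →ₗ[k] W := (LinearMap.applyₗ w).comp σ.toLinearMap
    have hev : ∀ c, ev c = σ c w := fun c => rfl
    let S : A ⊗[k] A →ₗ[k] A ⊗[k] W :=
      TensorProduct.map LinearMap.id (ev.comp G.antipode)
    let H : A ⊗[k] (A ⊗[k] A) →ₗ[k] A ⊗[k] W :=
      TensorProduct.map LinearMap.id (ev.comp ((LinearMap.mul' k A).comp
        (TensorProduct.map LinearMap.id G.antipode)))
    have h1 : ∀ z, Θ (S z) = H (Algebra.TensorProduct.assoc k k k A A A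
        (Algebra.TensorProduct.map G.comul (AlgHom.id k A) z)) := by
      intro z
      induction z with
      | zero => simp
      | add y z hy hz => simp only [map_add, hy, hz]
      | tmul c d =>
        simp only [S, TensorProduct.map_tmul, hΘ, Algebra.TensorProduct.map_tmul,
          LinearMap.id_apply, AlgHom.id_apply, LinearMap.comp_apply]
        generalize G.comul c = y
        induction y with
        | zero => simp
        | add y z hy hz => simp only [map_add, LinearMap.add_apply, hy, hz, TensorProduct.add_tmul]
        | tmul c e => simp [outer_tmul, H, hev, regularRep]
    have h2 : Θ (S (G.comul b)) = b ⊗ₜ w := by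
      rw [h1]
      have := DFunLike.congr_fun G.coassoc b
      simp only [AlgHom.comp_apply] at this
      erw [this]
      have h3 : ∀ z, H (Algebra.TensorProduct.map (AlgHom.id k A) G.comul z) =
          (Algebra.TensorProduct.rid k k A (Algebra.TensorProduct.map (AlgHom.id k A) aug z))
            ⊗ₜ[k] w := by
        intro z
        induction z with
        | zero => simp
        | add y z hy hz => simp only [map_add, hy, hz, TensorProduct.add_tmul]
        | tmul c d =>
          have := G.antipode_right d
          simp [H, this, hev, TensorProduct.smul_tmul', Algebra.algebraMap_eq_smul_one]
      rw [h3]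
      have := DFunLike.congr_fun G.counit_right b
      simp only [AlgHom.comp_apply] at this
      erw [this]
      rfl
    exact ⟨_, h2⟩
  have inj : Function.Injective Θ := LinearMap.injective_iff_surjective.2 surj
  refine ⟨LinearEquiv.ofBijective Θ ⟨inj, surj⟩, fun a z => ?_⟩
  change Θ _ = G.tensor (regularRep k A) σ a (Θ z)
  rw [leftRep_apply, tensor_apply]
  induction z with
  | zero => simp
  | add y z hy hz => simp only [map_add, hy, hz]
  | tmul b w => simp [hΘ, regularRep]

end GroupStructure

/-! ### The algebra `k[x, y]/(x², y²)` in coordinates -/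

namespace KAlg

variable {k : Type u} [Field k]

theorem exists_coord (a : KAlg k) : ∃ c₀ c₁ c₂ c₃ : k,
    a = c₀ • 1 + c₁ • x k + c₂ • y k + c₃ • (x k * y k) := by
  obtain ⟨p, rfl⟩ : ∃ p, mk k p = a := Ideal.Quotient.mk_surjective a
  induction p using MvPolynomial.induction_on with
  | C c => exact ⟨c, 0, 0, 0, by
      simp only [zero_smul, add_zero]
      rw [← Algebra.algebraMap_eq_smul_one, ← AlgHom.commutes (mk k)]; rfl⟩
  | add p q hp hq =>
    obtain ⟨a, b, c, d, h⟩ := hp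
    obtain ⟨a', b', c', d', h'⟩ := hq
    refine ⟨a + a', b + b', c + c', d + d', ?_⟩
    rw [map_add, h, h']
    module
  | mul_X p i hp =>
    obtain ⟨a, b, c, d, h⟩ := hp
    rw [map_mul, h]
    have hx := x_mul_x k
    have hy := y_mul_y k
    fin_cases i
    · refine ⟨0, a, 0, c, ?_⟩
      change _ * x k = _
      simp only [add_mul, smul_mul_assoc, one_mul, hx, mul_comm (y k) (x k), mul_assoc]
      rw [← mul_assoc (x k) (x k), hx]
      simp
    · refine ⟨0, 0, a, b, ?_⟩
      change _ * y k = _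
      simp only [add_mul, smul_mul_assoc, one_mul, hy, mul_assoc]
      simp

theorem coord_eq_zero {c₀ c₁ c₂ c₃ : k}
    (h : c₀ • 1 + c₁ • x k + c₂ • y k + c₃ • (x k * y k) = 0) :
    c₀ = 0 ∧ c₁ = 0 ∧ c₂ = 0 ∧ c₃ = 0 := by
  -- the isomorphism of `A` with the dual numbers over the dual numbers
  have hx : (TrivSqZeroExt.inl DualNumber.eps : k[ε][ε]) * TrivSqZeroExt.inl DualNumber.eps = 0 := by
    ext <;> simp
  let f := lift (k := k) (B := k[ε][ε]) (TrivSqZeroExt.inl DualNumber.eps) DualNumber.eps hx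
    DualNumber.eps_mul_eps
  have h' := congrArg f h
  simp only [f, map_add, map_smul, map_mul, map_one, lift_x, lift_y, map_zero] at h'
  have e₁ := congrArg (fun z => TrivSqZeroExt.fst (TrivSqZeroExt.fst z)) h'
  have e₂ := congrArg (fun z => TrivSqZeroExt.snd (TrivSqZeroExt.fst z)) h'
  have e₃ := congrArg (fun z => TrivSqZeroExt.fst (TrivSqZeroExt.snd z)) h'
  have e₄ := congrArg (fun z => TrivSqZeroExt.snd (TrivSqZeroExt.snd z)) h'
  simp at e₁ e₂ e₃ e₄
  exact ⟨e₁, e₂, e₃, e₄⟩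

/-- The coordinates with respect to the basis `1, x, y, xy`. -/
noncomputable def coordEquiv (k : Type u) [Field k] : (k × k × k × k) ≃ₗ[k] KAlg k :=
  LinearEquiv.ofBijective
    { toFun := fun c => c.1 • 1 + c.2.1 • x k + c.2.2.1 • y k + c.2.2.2 • (x k * y k)
      map_add' := fun c d => by simp only [Prod.fst_add, Prod.snd_add]; module
      map_smul' := fun t c => by
        simp only [Prod.smul_fst, Prod.smul_snd, RingHom.id_apply, smul_eq_mul]; module } <| by
    constructor
    · rw [← LinearMap.ker_eq_bot, LinearMap.ker_eq_bot']
      rintro ⟨a, b, c, d⟩ h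
      obtain ⟨rfl, rfl, rfl, rfl⟩ := coord_eq_zero h
      rfl
    · intro a
      obtain ⟨c₀, c₁, c₂, c₃, h⟩ := exists_coord a
      exact ⟨(c₀, c₁, c₂, c₃), h.symm⟩

instance : FiniteDimensional k (KAlg k) := (coordEquiv k).finiteDimensional

theorem finrank_eq : Module.finrank k (KAlg k) = 4 := by
  rw [← (coordEquiv k).finrank_eq]
  simp

/-- The linear element `v₀ x + v₁ y`. -/
noncomputable def lin (v : Fin 2 → k) : KAlg k := v 0 • x k + v 1 • y k

theorem aug_lin (v : Fin 2 → k) : aug k (lin v) = 0 := by simp [lin]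

theorem lin_smul (c : k) (v : Fin 2 → k) : lin (c • v) = c • lin v := by
  simp [lin, mul_smul]

theorem lin_add (v w : Fin 2 → k) : lin (v + w) = lin v + lin w := by
  simp only [lin, Pi.add_apply]; module

theorem lin_injective : Function.Injective (lin (k := k)) := by
  intro v w h
  have h0 : (0 : k) • 1 + (v 0 - w 0) • x k + (v 1 - w 1) • y k + (0 : k) • (x k * y k) = 0 := by
    have : lin v - lin w = 0 := sub_eq_zero.2 h
    rw [← this]
    simp only [lin]
    module
  obtain ⟨-, h1, h2, -⟩ := coord_eq_zero h0
  ext i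
  fin_cases i
  · exact sub_eq_zero.1 h1
  · exact sub_eq_zero.1 h2

section CharTwo

variable [CharP k 2]

theorem lin_mul_self (v : Fin 2 → k) : lin v * lin v = 0 := by
  have h := congrArg (linearPoint v) (DualNumber.eps_mul_eps (R := k))
  rwa [map_mul, linearPoint_eps, map_zero] at h

theorem lin_mul_lin (v w : Fin 2 → k) :
    lin w * lin v = (v 0 * w 1 - v 1 * w 0) • (x k * y k) := by
  have hx := x_mul_x k
  have hy := y_mul_y k
  rw [CharTwo.sub_eq_add]
  simp only [lin, add_mul, mul_add, smul_mul_smul_comm, hx, hy, mul_comm (y k) (x k)]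
  module

variable {v w : Fin 2 → k} (h : LinearIndependent k ![v, w])
include h

theorem x_mul_y_eq : x k * y k = (v 0 * w 1 - v 1 * w 0)⁻¹ • (lin w * lin v) := by
  rw [lin_mul_lin, smul_smul, inv_mul_cancel₀ (det_ne_zero h), one_smul]

omit [CharP k 2] in
theorem x_eq : x k = (v 0 * w 1 - v 1 * w 0)⁻¹ • (w 1 • lin v - v 1 • lin w) := by
  rw [eq_inv_smul_iff₀ (det_ne_zero h), lin, lin]
  module

omit [CharP k 2] in
theorem y_eq : y k = (v 0 * w 1 - v 1 * w 0)⁻¹ • (v 0 • lin w - w 0 • lin v) := by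
  rw [eq_inv_smul_iff₀ (det_ne_zero h), lin, lin]
  module

theorem exists_coord_lin (a : KAlg k) : ∃ c₀ c₁ c₂ c₃ : k,
    a = c₀ • 1 + c₁ • lin w + c₂ • lin v + c₃ • (lin w * lin v) := by
  obtain ⟨c₀, c₁, c₂, c₃, rfl⟩ := exists_coord a
  rw [x_mul_y_eq h]
  set d := (v 0 * w 1 - v 1 * w 0)⁻¹
  refine ⟨c₀, d * (c₂ * v 0 - c₁ * v 1), d * (c₁ * w 1 - c₂ * w 0), c₃ * d, ?_⟩
  rw [x_eq h, y_eq h]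
  change _ + c₁ • (d • _) + c₂ • (d • _) + c₃ • (d • _) = _
  module

omit h in
/-- A linear bijection that commutes with two independent linear elements of `A` is an isomorphism
of `A`-modules. -/
theorem repIso_of_lin (h : LinearIndependent k ![v, w])
    {V W : Type*} [AddCommGroup V] [Module k V] [AddCommGroup W] [Module k W]
    {ρ : KAlg k →ₐ[k] Module.End k V} {σ : KAlg k →ₐ[k] Module.End k W} (e : V ≃ₗ[k] W)
    (h₁ : ∀ z, e (ρ (lin v) z) = σ (lin v) (e z)) (h₂ : ∀ z, e (ρ (lin w) z) = σ (lin w) (e z)) :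
    RepIso ρ σ := by
  refine ⟨e, fun a z => ?_⟩
  obtain ⟨c₀, c₁, c₂, c₃, rfl⟩ := exists_coord_lin h a
  simp [h₁, h₂]

end CharTwo

end KAlg

/-! ### Points of the projective line in degree one, and noble points -/

section DegreeOne

variable {k : Type*} [Field k] {A : Type*} [CommRing A] [Algebra k A] {aug : A →ₐ[k] k}

/-- A linear functional as a cochain of degree one. -/
noncomputable def cochainOne (f : A →ₗ[k] k) : Cochain k A 1 where
  toFun a := f (a 0)
  map_update_add' a i x y := by
    obtain rfl := Subsingleton.elim i 0
    simp
  map_update_smul' a i c x := by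
    obtain rfl := Subsingleton.elim i 0
    simp

theorem cochainOne_apply (f : A →ₗ[k] k) (a : Fin 1 → A) : cochainOne f a = f (a 0) := rfl

theorem isCocycle_cochainOne {f : A →ₗ[k] k} (hf : ∀ a b, f (a * b) = aug a * f b + f a * aug b) :
    IsCocycle aug (cochainOne f) := by
  intro a
  simp only [coboundary, cochainOne_apply, Finset.univ_unique, Finset.sum_singleton]
  have h : Fin.contractNth (Fin.castSucc (default : Fin 1)) (· * ·) a 0 = a 0 * a 1 := by
    rw [Fin.contractNth_apply_of_eq _ _ _ _ (by simp)]
    rfl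
  rw [h, hf]
  simp [Fin.tail, Fin.init]

/-- A class of degree one vanishes at the point of `α : k[t]/t² → A` if and only if the derivation
that represents it kills `α(t)`: no power of a nonzero class of degree one of `k[t]/t²` is a
coboundary, because a coboundary vanishes on `(t, …, t)`. -/
theorem cochainOne_mem_pointOf {f : A →ₗ[k] k}
    (hf : ∀ a b, f (a * b) = aug a * f b + f a * aug b) (α : k[ε] →ₐ[k] A) :
    (⟨1, cochainOne f⟩ : Σ n : ℕ, Cochain k A n) ∈ pointOf aug α ↔ f (α DualNumber.eps) = 0 := by
  constructor
  · rintro ⟨-, m, hm, hb⟩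
    obtain ⟨m, rfl⟩ : ∃ l, m = l + 1 := ⟨m - 1, by omega⟩
    have key : ∀ (N : ℕ) (g : (Fin N → k[ε]) → k), 0 < N → IsCoboundary (dualAug k) N g →
        g (fun _ => DualNumber.eps) = 0 := by
      rintro (_ | N) g hN hg
      · omega
      · obtain ⟨h, hh⟩ := hg
        rw [hh]
        have h0 : dualAug k DualNumber.eps = 0 := by simp [dualAug]
        have hc : ∀ j : Fin N, h (Fin.contractNth j.castSucc (· * ·)
            fun _ : Fin (N + 1) => (DualNumber.eps : k[ε])) = 0 := by
          intro j
          apply h.map_coord_zero j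
          rw [Fin.contractNth_apply_of_eq _ _ _ _ (by simp)]
          exact DualNumber.eps_mul_eps
        simp [coboundary, h0, hc]
    have h1 := key _ _ (by simp) hb
    simp only [cupPow, Finset.prod_const, cochainOne_apply, Function.comp_apply] at h1
    exact pow_eq_zero_iff (by simp) |>.1 h1
  · intro h0
    refine ⟨isCocycle_cochainOne hf, 1, one_pos, ?_⟩
    refine ⟨0, fun a => ?_⟩
    have hz : ∀ b, f (α b) = 0 := by
      intro b
      have hb : b = algebraMap k k[ε] b.fst + b.snd • DualNumber.eps := by
        ext <;> simp [TrivSqZeroExt.algebraMap_eq_inl]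
      have h1 : f 1 = 0 := by simpa using hf 1 1
      rw [hb, map_add, map_smul, AlgHom.commutes, map_add, map_smul, h0,
        Algebra.algebraMap_eq_smul_one, map_smul, h1]
      simp
    simp [cupPow, coboundary, cochainOne_apply, hz]

end DegreeOne

namespace KAlg

variable {k : Type u} [Field k]

/-- The map `A → k[t]/t²` with `x ↦ a t`, `y ↦ b t`. -/
noncomputable def toDual (a b : k) : KAlg k →ₐ[k] k[ε] :=
  lift (a • DualNumber.eps) (b • DualNumber.eps)
    (by simp [DualNumber.eps_mul_eps]) (by simp [DualNumber.eps_mul_eps])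

theorem fst_toDual (a b : k) (z : KAlg k) : TrivSqZeroExt.fst (toDual a b z) = aug k z := by
  refine DFunLike.congr_fun (algHom_ext (f := (TrivSqZeroExt.fstHom k k k).comp (toDual a b))
    (g := aug k) ?_ ?_) z <;> simp [toDual]

/-- The `k`-valued derivation of `A` with `x ↦ a`, `y ↦ b`. -/
noncomputable def deriv (a b : k) : KAlg k →ₗ[k] k :=
  (TrivSqZeroExt.sndHom k k).comp (toDual a b).toLinearMap

theorem deriv_mul (a b : k) (z w : KAlg k) :
    deriv a b (z * w) = aug k z * deriv a b w + deriv a b z * aug k w := by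
  simp only [deriv, LinearMap.comp_apply, AlgHom.toLinearMap_apply, map_mul,
    TrivSqZeroExt.sndHom_apply, DualNumber.snd_mul, fst_toDual]

theorem deriv_coord (a b c₀ c₁ c₂ c₃ : k) :
    deriv a b (c₀ • 1 + c₁ • x k + c₂ • y k + c₃ • (x k * y k)) = c₁ * a + c₂ * b := by
  have h1 : deriv a b (1 : KAlg k) = 0 := by simpa using deriv_mul a b 1 1
  have hx : deriv a b (x k) = a := by simp [deriv, toDual]
  have hy : deriv a b (y k) = b := by simp [deriv, toDual]
  simp [h1, hx, hy, deriv_mul]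

theorem deriv_lin (a b : k) (v : Fin 2 → k) : deriv a b (lin v) = v 0 * a + v 1 * b := by
  rw [← deriv_coord a b 0 (v 0) (v 1) 0]
  simp [lin]

end KAlg

open KAlg

variable {k : Type u} [Field k] [CharP k 2]

/-- If `[v]` is noble for `G`, then a generator of the group algebra `k[S]/S²` of the corresponding
subgroup scheme has linear part `v₀ x + v₁ y`, up to a scalar. -/
theorem exists_of_isNobleAt {G : GroupStructure (aug k)} {v : Fin 2 → k} (hv : v ≠ 0)
    (h : G.IsNobleAt (linearPoint v)) : ∃ (S : KAlg k) (d c : k), S = lin v + d • (x k * y k) ∧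
      G.comul S = S ⊗ₜ 1 + 1 ⊗ₜ S + c • (S ⊗ₜ[k] S) := by
  obtain ⟨C, e, hC, -, hp⟩ := h
  set α : k[ε] →ₐ[k] KAlg k := C.val.comp e.toAlgHom with hα
  set T := α DualNumber.eps with hT
  have hmem : ∀ a b, deriv a b T = 0 ↔ v 0 * a + v 1 * b = 0 := by
    intro a b
    rw [← cochainOne_mem_pointOf (deriv_mul a b) α, hp, cochainOne_mem_pointOf (deriv_mul a b),
      linearPoint_eps, ← deriv_lin]
    rfl
  have hTT : T * T = 0 := by rw [hT, ← map_mul, DualNumber.eps_mul_eps, map_zero]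
  have haugT : aug k T = 0 := by
    have := congrArg (aug k) hTT
    rwa [map_mul, map_zero, mul_self_eq_zero] at this
  -- `T = c (v₀ x + v₁ y) + c₃ x y` with `c ≠ 0`
  obtain ⟨c, c₃, hc, hTc⟩ : ∃ c c₃ : k, c ≠ 0 ∧ T = c • lin v + c₃ • (x k * y k) := by
    obtain ⟨c₀, c₁, c₂, c₃, hTe⟩ := exists_coord T
    have hc0 : c₀ = 0 := by
      have := haugT
      rw [hTe] at this
      simpa using this
    subst hc0
    rw [hTe] at hmem
    simp only [deriv_coord] at hmem
    have h1 : c₁ * v 1 = c₂ * v 0 := by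
      have := (hmem (v 1) (-v 0)).2 (by ring)
      linear_combination this
    by_cases h0 : v 0 = 0
    · have hv1 : v 1 ≠ 0 := by
        intro h
        apply hv
        ext i
        fin_cases i
        · exact h0
        · exact h
      have hc1 : c₁ = 0 := by
        rw [h0, mul_zero] at h1
        exact (mul_eq_zero.1 h1).resolve_right hv1
      refine ⟨c₂ / v 1, c₃, div_ne_zero (fun h => ?_) hv1, ?_⟩
      · exact hv1 (by simpa [hc1, h] using (hmem 0 1).1)
      · rw [hTe, hc1, lin, h0]
        simp [smul_smul, hv1]
    · refine ⟨c₁ / v 0, c₃, div_ne_zero (fun h => ?_) h0, ?_⟩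
      · have hc2 : c₂ = 0 := by
          rw [h, zero_mul, eq_comm] at h1
          exact (mul_eq_zero.1 h1).resolve_right h0
        exact h0 (by simpa [hc2, h] using (hmem 1 0).1)
      · have hc2 : c₁ / v 0 * v 1 = c₂ := by
          rw [div_mul_eq_mul_div, h1, mul_div_assoc, div_self h0, mul_one]
        rw [hTe, lin, smul_add, smul_smul, smul_smul, hc2, div_mul_cancel₀ _ h0]
        simp
  have hT0 : T ≠ 0 := by
    intro h
    rw [h, eq_comm] at hTc
    have : (0 : k) • 1 + (c * v 0) • x k + (c * v 1) • y k + c₃ • (x k * y k) = 0 := by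
      rw [← hTc, lin]
      module
    obtain ⟨-, h1, h2, -⟩ := coord_eq_zero this
    apply hv
    ext i
    fin_cases i
    · exact (mul_eq_zero.1 h1).resolve_left hc
    · exact (mul_eq_zero.1 h2).resolve_left hc
  -- the elements of `C` are the combinations of `1` and `T`
  have hCT : ∀ z : C, ∃ a b : k, (z : KAlg k) = a • 1 + b • T := by
    intro z
    obtain ⟨z, rfl⟩ := e.surjective z
    refine ⟨z.fst, z.snd, ?_⟩
    have hz : z = algebraMap k k[ε] z.fst + z.snd • DualNumber.eps := by
      ext <;> simp [TrivSqZeroExt.algebraMap_eq_inl]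
    change α z = _
    nth_rewrite 1 [hz]
    rw [map_add, map_smul, AlgHom.commutes, Algebra.algebraMap_eq_smul_one]
  have hΔ : ∃ a b b' l : k, G.comul T =
      a • (1 ⊗ₜ 1) + b • (1 ⊗ₜ T) + b' • (T ⊗ₜ 1) + l • (T ⊗ₜ[k] T) := by
    obtain ⟨z, hz⟩ := hC.1 T (e DualNumber.eps).2
    rw [← hz]
    clear hz
    induction z with
    | zero => exact ⟨0, 0, 0, 0, by simp⟩
    | add z w hz hw =>
      obtain ⟨a, b, b', l, hz⟩ := hz
      obtain ⟨a₁, b₁, b₁', l₁, hw⟩ := hw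
      refine ⟨a + a₁, b + b₁, b' + b₁', l + l₁, ?_⟩
      rw [map_add]
      erw [hz, hw]
      module
    | tmul z w =>
      obtain ⟨a, b, hz⟩ := hCT z
      obtain ⟨a', b', hw⟩ := hCT w
      refine ⟨a * a', a * b', b * a', b * b', ?_⟩
      change (z : KAlg k) ⊗ₜ[k] (w : KAlg k) = _
      rw [hz, hw]
      simp only [TensorProduct.add_tmul, TensorProduct.tmul_add, TensorProduct.smul_tmul_smul]
      module
  obtain ⟨a, b, b', l, hΔ⟩ := hΔ
  have ind : ∀ a b : k, a • (1 : KAlg k) + b • T = T → a = 0 ∧ b = 1 := by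
    intro a b hab
    have ha : a = 0 := by simpa [haugT] using congrArg (aug k) hab
    subst ha
    refine ⟨rfl, ?_⟩
    have : (b - 1) • T = 0 := by rw [sub_smul, one_smul]; simpa [sub_eq_zero] using hab
    simpa [hT0, sub_eq_zero] using this
  have hl := DFunLike.congr_fun G.counit_left T
  have hr := DFunLike.congr_fun G.counit_right T
  simp only [AlgHom.comp_apply, hΔ] at hl hr
  simp [haugT] at hl hr
  obtain ⟨ha, hb⟩ := ind a b hl
  obtain ⟨-, hb'⟩ := ind a b' hr
  refine ⟨c⁻¹ • T, c⁻¹ * c₃, l * c, ?_, ?_⟩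
  · rw [hTc, smul_add, smul_smul, smul_smul, inv_mul_cancel₀ hc, one_smul]
  · rw [map_smul, hΔ, ha, hb, hb']
    simp only [← TensorProduct.smul_tmul', TensorProduct.tmul_smul, smul_smul]
    have : l * c * (c⁻¹ * c⁻¹) = c⁻¹ * l := by field_simp
    rw [this]
    module

theorem flat_linearPoint {v w : Fin 2 → k} (h : LinearIndependent k ![v, w]) :
    (linearPoint v).toRingHom.Flat := by
  algebraize [(linearPoint v).toRingHom]
  have hsm : ∀ (a : k[ε]) (z : KAlg k), a • z = linearPoint v a * z := fun a z => rfl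
  let f : (k[ε] × k[ε]) →ₗ[k[ε]] KAlg k :=
    { toFun := fun a => linearPoint v a.1 + linearPoint v a.2 * lin w
      map_add' := fun a b => by simp; ring
      map_smul' := fun a b => by simp [hsm]; ring }
  have hf : ∀ a, f a = linearPoint v a.1 + linearPoint v a.2 * lin w := fun a => rfl
  let g : (k[ε] × k[ε]) →ₗ[k] KAlg k :=
    { toFun := f
      map_add' := map_add f
      map_smul' := fun c a => by simp [hf] }
  have hg : Function.Surjective f := by
    intro a
    obtain ⟨c₀, c₁, c₂, c₃, rfl⟩ := exists_coord_lin h a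
    refine ⟨(c₀ • 1 + c₂ • DualNumber.eps, c₁ • 1 + c₃ • DualNumber.eps), ?_⟩
    rw [hf]
    simp only [map_add, map_smul, map_one, linearPoint_eps, ← lin.eq_1, add_mul, smul_mul_assoc,
      one_mul, mul_comm (lin v) (lin w)]
    abel
  have hd : Module.finrank k k[ε] = 2 := by
    change Module.finrank k (k × k) = 2
    simp
  have : FiniteDimensional k k[ε] := inferInstanceAs (FiniteDimensional k (k × k))
  have hg' : Function.Injective g :=
    (LinearMap.injective_iff_surjective_of_finrank_eq_finrank
      (by rw [Module.finrank_prod, hd, finrank_eq])).2 hg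
  exact Module.Flat.of_linearEquiv (LinearEquiv.ofBijective f ⟨hg', hg⟩).symm

theorem G₀_lin (v : Fin 2 → k) : (G₀ k).comul (lin v) = lin v ⊗ₜ 1 + 1 ⊗ₜ lin v := by
  simp only [lin, map_add, map_smul, G₀_x, G₀_y, TensorProduct.add_tmul, TensorProduct.tmul_add,
    ← TensorProduct.smul_tmul', TensorProduct.tmul_smul]
  module

/-- Every point is noble for `G₀`: all linear elements of `A` are primitive. -/
theorem isNobleAt_G₀ {v w : Fin 2 → k} (h : LinearIndependent k ![v, w]) :
    (G₀ k).IsNobleAt (linearPoint v) := by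
  have hv : v ≠ 0 := by simpa using h.ne_zero 0
  have heps : linearPoint v DualNumber.eps = lin v := linearPoint_eps v
  have inj : Function.Injective (linearPoint v) := by
    rw [injective_iff_map_eq_zero]
    intro z hz
    have hz' : z = algebraMap k k[ε] z.fst + z.snd • DualNumber.eps := by
      ext <;> simp [TrivSqZeroExt.algebraMap_eq_inl]
    rw [hz', map_add, map_smul, AlgHom.commutes, Algebra.algebraMap_eq_smul_one, heps] at hz
    have h1 : z.fst = 0 := by simpa [aug_lin] using congrArg (aug k) hz
    rw [h1, zero_smul, zero_add, ← lin_smul] at hz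
    have h2 : z.snd • v = 0 := lin_injective (by rw [hz]; simp [lin])
    rw [hz', h1, (smul_eq_zero.1 h2).resolve_right hv]
    simp
  have hsub : (G₀ k).IsSubgroup (linearPoint v).range := by
    refine ⟨?_, fun a ha => ha⟩
    rintro _ ⟨z, rfl⟩
    have hz' : z = algebraMap k k[ε] z.fst + z.snd • DualNumber.eps := by
      ext <;> simp [TrivSqZeroExt.algebraMap_eq_inl]
    rw [hz']
    change (G₀ k).comul (linearPoint v _) ∈ _
    rw [map_add, map_smul, AlgHom.commutes, map_add, AlgHom.commutes, map_smul, heps, G₀_lin]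
    refine add_mem (Subalgebra.algebraMap_mem _ _) (Subalgebra.smul_mem _ ?_ _)
    let t : (linearPoint v).range := ⟨lin v, DualNumber.eps, heps⟩
    exact ⟨t ⊗ₜ 1 + 1 ⊗ₜ t, by simp [t]⟩
  let e : k[ε] ≃ₐ[k] (linearPoint v).range := AlgEquiv.ofInjective _ inj
  have he : (linearPoint v).range.val.comp e.toAlgHom = linearPoint v := by
    ext; rfl
  refine ⟨_, e, hsub, ⟨?_, _, hsub, ?_, fun a _ b _ => mul_comm a b, ?_⟩, ?_⟩
  · rw [he]
    exact flat_linearPoint h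
  · exact e.toRingEquiv.isLocalRing
  · rw [he]
  · rw [he]

/-! ### Modules of Loewy length two over a noble point -/

section RingIdentities

variable {k : Type*} [Field k] {E : Type*} [Ring E] [Algebra k E]

theorem one_add_mul_of_mul_eq {X s z : E} (h : X * s = s * X + z) (hz : z * X = 0) :
    (1 + X) * s = (s + z) * (1 + X) := by
  rw [add_mul, one_mul, h, mul_add, mul_one, add_mul s z X, hz]
  abel

/-- Relations between operators on a tensor product: `rᵢ` are commuting square-zero operators with
projections `eᵢ` onto their images, `h` is a grading operator of `n₂`, `[h, n₂] = n₂`, and the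
remaining commutators that matter vanish; nothing is assumed about `h` and `θ`. -/
structure TwistData (r₁ r₂ n₁ n₂ e₁ e₂ h θ : E) : Prop where
  r₁r₁ : r₁ * r₁ = 0
  r₂r₂ : r₂ * r₂ = 0
  r₁e₁ : r₁ * e₁ = 0
  r₂e₂ : r₂ * e₂ = 0
  e₁r₁ : e₁ * r₁ = r₁
  e₂r₂ : e₂ * r₂ = r₂
  hn₂ : h * n₂ = n₂ * h + n₂
  r₂r₁ : Commute r₂ r₁
  r₂e₁ : Commute r₂ e₁
  e₂r₁ : Commute e₂ r₁
  n₁r₁ : Commute n₁ r₁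
  n₁r₂ : Commute n₁ r₂
  n₁e₁ : Commute n₁ e₁
  n₁e₂ : Commute n₁ e₂
  n₂r₁ : Commute n₂ r₁
  n₂r₂ : Commute n₂ r₂
  n₂e₁ : Commute n₂ e₁
  n₂e₂ : Commute n₂ e₂
  n₂n₁ : Commute n₂ n₁
  hr₁ : Commute h r₁
  hr₂ : Commute h r₂
  hn₁ : Commute h n₁
  θr₁ : Commute θ r₁
  θr₂ : Commute θ r₂
  θe₂ : Commute θ e₂
  θn₁ : Commute θ n₁
  θn₂ : Commute θ n₂

namespace TwistData

variable {r₁ r₂ n₁ n₂ e₁ e₂ h θ : E} (c d : k)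

/-- The nilpotent part of the intertwiner. -/
def twist (r₁ r₂ n₁ e₁ e₂ h θ : E) (c d : k) : E :=
  d • (r₂ * e₁) + r₁ * (θ - d • 1) * e₂ + (r₁ + r₂) * h * (c • n₁ - θ + (2 * d) • 1)

variable (H : TwistData r₁ r₂ n₁ n₂ e₁ e₂ h θ)
include H

theorem zero₁ (z : E) : r₁ * (r₁ * z) = 0 := by rw [← mul_assoc, H.r₁r₁, zero_mul]
theorem zero₂ (z : E) : r₂ * (r₂ * z) = 0 := by rw [← mul_assoc, H.r₂r₂, zero_mul]
theorem zero₃ (z : E) : r₁ * (e₁ * z) = 0 := by rw [← mul_assoc, H.r₁e₁, zero_mul]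
theorem zero₄ (z : E) : r₂ * (e₂ * z) = 0 := by rw [← mul_assoc, H.r₂e₂, zero_mul]
theorem er₁ (z : E) : e₁ * (r₁ * z) = r₁ * z := by rw [← mul_assoc, H.e₁r₁]
theorem er₂ (z : E) : e₂ * (r₂ * z) = r₂ * z := by rw [← mul_assoc, H.e₂r₂]
theorem hn (z : E) : h * (n₂ * z) = n₂ * (h * z) + n₂ * z := by
  rw [← mul_assoc, H.hn₂, add_mul, mul_assoc]

theorem twist_mul_sum : twist r₁ r₂ n₁ e₁ e₂ h θ c d * (r₁ + r₂) =
    (r₁ + r₂) * twist r₁ r₂ n₁ e₁ e₂ h θ c d + θ * (r₁ * r₂) := by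
  simp only [twist, mul_add, add_mul, mul_sub, sub_mul, smul_mul_assoc, mul_smul_comm, mul_one,
    mul_assoc, H.r₂r₂, H.r₂e₂, H.e₂r₂, H.zero₁, H.zero₂,
    H.zero₃, H.zero₄, H.er₁, H.er₂, H.r₂r₁.eq, H.r₂r₁.left_comm, H.r₂e₁.eq, H.r₂e₁.left_comm,
    H.e₂r₁.eq, H.e₂r₁.left_comm, H.n₁r₁.left_comm, H.n₁r₂.left_comm,
    H.hr₁.eq, H.hr₁.left_comm, H.hr₂.eq, H.hr₂.left_comm,
    H.hn₁.eq, H.θr₁.eq, H.θr₁.left_comm, H.θr₂.eq, H.θe₂.eq, mul_zero, smul_zero]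
  module

theorem twist_mul_nilp : twist r₁ r₂ n₁ e₁ e₂ h θ c d * (r₁ * n₁ + r₂ * n₂) =
    (r₁ * n₁ + r₂ * n₂) * twist r₁ r₂ n₁ e₁ e₂ h θ c d +
      (c • (n₁ * n₂) + d • (n₁ + n₂)) * (r₁ * r₂) := by
  simp only [twist, mul_add, add_mul, mul_sub, sub_mul, smul_mul_assoc, mul_smul_comm, mul_one,
    mul_assoc, H.hn₂, H.zero₁, H.zero₂,
    H.zero₃, H.zero₄, H.er₁, H.er₂, H.hn, H.r₂r₁.left_comm, H.r₂e₁.eq, H.r₂e₁.left_comm,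
    H.e₂r₁.left_comm, H.n₁r₁.left_comm, H.n₁r₂.eq, H.n₁r₂.left_comm,
    H.n₁e₁.left_comm, H.n₁e₂.eq, H.n₁e₂.left_comm, H.n₂r₁.left_comm,
    H.n₂r₂.eq, H.n₂r₂.left_comm, H.n₂e₁.left_comm, H.n₂e₂.eq, H.n₂e₂.left_comm,
    H.n₂n₁.left_comm, H.hr₁.left_comm, H.hr₂.left_comm,
    H.hn₁.eq, H.hn₁.left_comm, H.θr₁.left_comm, H.θr₂.left_comm,
    H.θe₂.eq, H.θn₁.eq, H.θn₂.eq, mul_zero, smul_zero]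
  module

theorem mul_twist : r₁ * r₂ * twist r₁ r₂ n₁ e₁ e₂ h θ c d = 0 := by
  simp only [twist, mul_add, add_mul, mul_sub, sub_mul, smul_mul_assoc, mul_smul_comm, mul_one,
    mul_assoc, H.zero₁, H.zero₂, H.r₂r₁.left_comm, mul_zero, smul_zero]
  simp

theorem isNilpotent_twist : IsNilpotent (twist r₁ r₂ n₁ e₁ e₂ h θ c d) := by
  set X := twist r₁ r₂ n₁ e₁ e₂ h θ c d with hX
  set ψ := c • n₁ - θ + (2 * d) • 1 with hψ
  have hX' : X = r₂ * (d • e₁ + h * ψ) + r₁ * ((θ - d • 1) * e₂ + h * ψ) := by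
    rw [hX, twist, ← hψ]
    simp only [mul_add, add_mul, mul_smul_comm, mul_assoc]
    abel
  have ψr₁ : Commute ψ r₁ := by
    rw [hψ]
    exact ((H.n₁r₁.smul_left c).sub_left H.θr₁).add_left ((Commute.one_left _).smul_left _)
  have ψr₂ : Commute ψ r₂ := by
    rw [hψ]
    exact ((H.n₁r₂.smul_left c).sub_left H.θr₂).add_left ((Commute.one_left _).smul_left _)
  have h₁ : X * r₁ = r₁ * r₂ * (d • 1 + h * ψ) := by
    rw [hX']
    simp only [add_mul, mul_add, sub_mul, mul_sub, mul_assoc, smul_mul_assoc, mul_smul_comm,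
      H.e₁r₁, H.e₂r₁.eq, ψr₁.eq, H.hr₁.left_comm, H.zero₁, H.r₂r₁.eq, H.r₂r₁.left_comm,
      H.θr₁.left_comm, mul_one, one_mul]
    simp
  have h₂ : X * r₂ = r₁ * r₂ * (θ - d • 1 + h * ψ) := by
    rw [hX']
    simp only [add_mul, mul_add, sub_mul, mul_sub, mul_assoc, smul_mul_assoc, mul_smul_comm,
      H.e₂r₂, ← H.r₂e₁.eq, ψr₂.eq, H.hr₂.left_comm, H.zero₂, H.θr₂.eq, mul_one, one_mul]
    simp
  have h₃ : X * (r₁ * r₂) = 0 := by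
    rw [← mul_assoc, h₁, mul_assoc (r₁ * r₂)]
    have : (d • 1 + h * ψ) * r₂ = r₂ * (d • 1 + h * ψ) :=
      (((Commute.one_left _).smul_left _).add_left (H.hr₂.mul_left ψr₂)).eq
    rw [this, ← mul_assoc, mul_assoc r₁, H.r₂r₂]
    simp
  refine ⟨3, ?_⟩
  have : X ^ 3 = X * (X * X) := by rw [pow_succ', pow_two]
  rw [this]
  nth_rewrite 3 [hX']
  rw [mul_add, ← mul_assoc X r₂, ← mul_assoc X r₁, h₁, h₂, mul_add]
  rw [mul_assoc (r₁ * r₂), mul_assoc (r₁ * r₂), ← mul_assoc X (r₁ * r₂), ← mul_assoc X (r₁ * r₂),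
    h₃]
  simp

end TwistData

end RingIdentities

open KAlg GroupStructure

variable {k : Type u} [Field k]
  {M N : Type*} [AddCommGroup M] [Module k M] [AddCommGroup N] [Module k N]

/-- With `r = lin w` and `s = lin v`: the module is `W ⊕ rW` with `r : W ≅ rW`, and
`s` is `r` times an operator `n` that has a grading operator `h`, `[h, n] = n`. The projection onto
`rW` is `e`; both `n` and `h` are extended from `W` to commute with `r`. -/
structure BlockOps (ρ : KAlg k →ₐ[k] Module.End k M) (v w : Fin 2 → k)
    (e n h : Module.End k M) : Prop where
  er : e * ρ (lin w) = ρ (lin w)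
  re : ρ (lin w) * e = 0
  nr : Commute n (ρ (lin w))
  ne : Commute n e
  hr : Commute h (ρ (lin w))
  hn : h * n = n * h + n
  s_eq : ρ (lin v) = ρ (lin w) * n

/-- The projection `a ↦ a - ε(a)` onto the augmentation ideal. -/
noncomputable def augProj (k : Type u) [Field k] : KAlg k →ₗ[k] KAlg k :=
  LinearMap.id - (Algebra.linearMap k (KAlg k)).comp (aug k).toLinearMap

theorem augProj_apply (a : KAlg k) : augProj k a = a - aug k a • 1 := by
  simp [augProj, Algebra.algebraMap_eq_smul_one]

/-- On the augmentation ideal `I`, the element `Δ(a) - a ⊗ 1 - 1 ⊗ a` lies in `I ⊗ I`: it is the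
projection of `Δ(a)`. -/
theorem comul_eq (G : GroupStructure (aug k)) {a : KAlg k} (ha : aug k a = 0) :
    G.comul a = a ⊗ₜ 1 + 1 ⊗ₜ a + TensorProduct.map (augProj k) (augProj k) (G.comul a) := by
  have key : ∀ z, TensorProduct.map (augProj k) (augProj k) z = z
      - 1 ⊗ₜ (Algebra.TensorProduct.lid k (KAlg k)
          (Algebra.TensorProduct.map (aug k) (AlgHom.id k (KAlg k)) z))
      - (Algebra.TensorProduct.rid k k (KAlg k)
          (Algebra.TensorProduct.map (AlgHom.id k (KAlg k)) (aug k) z)) ⊗ₜ 1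
      + (aug k) (Algebra.TensorProduct.lid k (KAlg k)
          (Algebra.TensorProduct.map (aug k) (AlgHom.id k (KAlg k)) z)) • (1 ⊗ₜ[k] 1) := by
    intro z
    induction z with
    | zero => simp
    | add y z hy hz =>
      simp only [map_add, hy, hz, TensorProduct.add_tmul, TensorProduct.tmul_add]
      module
    | tmul b c =>
      simp only [TensorProduct.map_tmul, augProj_apply, Algebra.TensorProduct.map_tmul,
        AlgHom.id_apply, Algebra.TensorProduct.lid_tmul, Algebra.TensorProduct.rid_tmul,
        TensorProduct.sub_tmul, TensorProduct.tmul_sub, ← TensorProduct.smul_tmul',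
        TensorProduct.tmul_smul, map_smul, smul_eq_mul]
      module
  have hl : Algebra.TensorProduct.lid k (KAlg k)
      (Algebra.TensorProduct.map (aug k) (AlgHom.id k (KAlg k)) (G.comul a)) = a :=
    DFunLike.congr_fun G.counit_left a
  have hr : Algebra.TensorProduct.rid k k (KAlg k)
      (Algebra.TensorProduct.map (AlgHom.id k (KAlg k)) (aug k) (G.comul a)) = a :=
    DFunLike.congr_fun G.counit_right a
  rw [key, hl, hr, ha]
  module

variable [CharP k 2] {v w : Fin 2 → k}

theorem BlockOps.augProj_eq (hvw : LinearIndependent k ![v, w])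
    {ρ : KAlg k →ₐ[k] Module.End k M} {e n h : Module.End k M} (H : BlockOps ρ v w e n h)
    (a : KAlg k) : ∃ c₁ c₂ : k, ρ (augProj k a) = (c₁ • 1 + c₂ • n) * ρ (lin w) := by
  obtain ⟨c₀, c₁, c₂, c₃, rfl⟩ := exists_coord_lin hvw a
  refine ⟨c₁, c₂, ?_⟩
  have h0 : ρ (lin w * lin v) = 0 := by
    rw [map_mul, H.s_eq, ← mul_assoc, ← map_mul, lin_mul_self, map_zero, zero_mul]
  have h1 : aug k (c₀ • 1 + c₁ • lin w + c₂ • lin v + c₃ • (lin w * lin v)) = c₀ := by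
    simp [aug_lin]
  rw [augProj_apply, h1]
  simp only [map_sub, map_add, map_smul, h0, H.s_eq, H.nr.eq, add_mul, smul_mul_assoc, one_mul,
    map_one, smul_zero]
  module

/-- If a group scheme structure has a subgroup scheme with group algebra generated by
`S = lin v + d xy`, then on modules of Loewy length two over the point `[v]` its tensor product is
that of `G₀`. Here `Δ(lin w)` and `Δ(lin v)` act as `r₁ + r₂ + θ r₁r₂` and
`r₁n₁ + r₂n₂ + (c n₁n₂ - d'(n₁ + n₂)) r₁r₂`, and the operator `1 + twist` removes the terms with
`r₁r₂`. It would not, in general, if the coefficient of `r₁r₂` in `Δ(lin v)` had a constant term. -/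
theorem BlockOps.repIso_tensor (hvw : LinearIndependent k ![v, w])
    (G : GroupStructure (aug k)) {S : KAlg k} {d c : k} (hS : S = lin v + d • (x k * y k))
    (hΔ : G.comul S = S ⊗ₜ 1 + 1 ⊗ₜ S + c • (S ⊗ₜ[k] S))
    {ρ : KAlg k →ₐ[k] Module.End k M} {e n h : Module.End k M} (H : BlockOps ρ v w e n h)
    {σ : KAlg k →ₐ[k] Module.End k N} {e' n' h' : Module.End k N} (H' : BlockOps σ v w e' n' h') :
    RepIso ((G₀ k).tensor ρ σ) (G.tensor ρ σ) := by
  let L : Module.End k M →ₐ[k] Module.End k (M ⊗[k] N) :=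
    (Module.endTensorEndAlgHom (R := k) (S := k) (A := k) (M := M) (N := N)).comp
      Algebra.TensorProduct.includeLeft
  let R : Module.End k N →ₐ[k] Module.End k (M ⊗[k] N) :=
    (Module.endTensorEndAlgHom (R := k) (S := k) (A := k) (M := M) (N := N)).comp
      Algebra.TensorProduct.includeRight
  have hL : ∀ f, L f = TensorProduct.map f 1 := fun f => rfl
  have hR : ∀ f, R f = TensorProduct.map 1 f := fun f => rfl
  have hLR : ∀ f g, L f * R g = TensorProduct.map f g := fun f g => by
    rw [hL, hR, ← TensorProduct.map_mul, mul_one, one_mul]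
  have hRL : ∀ f g, Commute (R g) (L f) := fun f g => by
    rw [Commute, SemiconjBy, hLR, hL, hR, ← TensorProduct.map_mul, mul_one, one_mul]
  have hout : ∀ a b, outer ρ σ (a ⊗ₜ b) = L (ρ a) * R (σ b) := fun a b => by
    rw [hLR, outer_tmul]
  set r₁ := L (ρ (lin w)) with hr₁
  set r₂ := R (σ (lin w)) with hr₂
  have hrr : Commute r₂ r₁ := hRL _ _
  -- the action of the part of `Δ` in `I ⊗ I`, with `I` the augmentation ideal
  have hθ : ∀ z : KAlg k ⊗[k] KAlg k, ∃ θ : Module.End k (M ⊗[k] N),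
      outer ρ σ (TensorProduct.map (augProj k) (augProj k) z) = θ * (r₁ * r₂) ∧
      Commute θ r₁ ∧ Commute θ r₂ ∧ Commute θ (R e') ∧ Commute θ (L n) ∧ Commute θ (R n') := by
    intro z
    induction z with
    | zero => exact ⟨0, by simp, by simp⟩
    | add y z hy hz =>
      obtain ⟨θ, hy, h₁, h₂, h₃, h₄, h₅⟩ := hy
      obtain ⟨η, hz, g₁, g₂, g₃, g₄, g₅⟩ := hz
      exact ⟨θ + η, by rw [map_add, map_add, hy, hz, add_mul], h₁.add_left g₁, h₂.add_left g₂,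
        h₃.add_left g₃, h₄.add_left g₄, h₅.add_left g₅⟩
    | tmul a b =>
      obtain ⟨a₁, a₂, ha⟩ := H.augProj_eq hvw a
      obtain ⟨b₁, b₂, hb⟩ := H'.augProj_eq hvw b
      have cl : ∀ g, Commute n g → Commute (a₁ • 1 + a₂ • n) g := fun g hg =>
        ((Commute.one_left _).smul_left _).add_left (hg.smul_left _)
      have cr : ∀ g, Commute n' g → Commute (b₁ • 1 + b₂ • n') g := fun g hg =>
        ((Commute.one_left _).smul_left _).add_left (hg.smul_left _)
      have cL : ∀ g, Commute n g → Commute (L (a₁ • 1 + a₂ • n) * R (b₁ • 1 + b₂ • n')) (L g) :=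
        fun g hg => ((cl g hg).map L).mul_left (hRL _ _)
      have cR : ∀ g, Commute n' g → Commute (L (a₁ • 1 + a₂ • n) * R (b₁ • 1 + b₂ • n')) (R g) :=
        fun g hg => (hRL _ _).symm.mul_left ((cr g hg).map R)
      refine ⟨L (a₁ • 1 + a₂ • n) * R (b₁ • 1 + b₂ • n'), ?_, cL _ H.nr, cR _ H'.nr, cR _ H'.ne,
        cL _ (Commute.refl _), cR _ (Commute.refl _)⟩
      rw [TensorProduct.map_tmul, hout, ha, hb, map_mul, map_mul, mul_assoc, mul_assoc]
      congr 1
      rw [← mul_assoc, ← mul_assoc, (hRL _ _).eq]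
  obtain ⟨θ, hθ, θr₁, θr₂, θe₂, θn₁, θn₂⟩ := hθ (G.comul (lin w))
  have T : TwistData r₁ r₂ (L n) (R n') (L e) (R e') (R h') θ :=
    { r₁r₁ := by rw [hr₁, ← map_mul, ← map_mul, lin_mul_self, map_zero, map_zero]
      r₂r₂ := by rw [hr₂, ← map_mul, ← map_mul, lin_mul_self, map_zero, map_zero]
      r₁e₁ := by rw [hr₁, ← map_mul, H.re, map_zero]
      r₂e₂ := by rw [hr₂, ← map_mul, H'.re, map_zero]
      e₁r₁ := by rw [hr₁, ← map_mul, H.er]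
      e₂r₂ := by rw [hr₂, ← map_mul, H'.er]
      hn₂ := by rw [← map_mul, H'.hn, map_add, map_mul]
      r₂r₁ := hRL _ _
      r₂e₁ := hRL _ _
      e₂r₁ := hRL _ _
      n₁r₁ := H.nr.map L
      n₁r₂ := (hRL _ _).symm
      n₁e₁ := H.ne.map L
      n₁e₂ := (hRL _ _).symm
      n₂r₁ := hRL _ _
      n₂r₂ := H'.nr.map R
      n₂e₁ := hRL _ _
      n₂e₂ := H'.ne.map R
      n₂n₁ := hRL _ _
      hr₁ := hRL _ _
      hr₂ := H'.hr.map R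
      hn₁ := hRL _ _
      θr₁ := θr₁
      θr₂ := θr₂
      θe₂ := θe₂
      θn₁ := θn₁
      θn₂ := θn₂ }
  -- the actions of `lin w` and `lin v` for both structures
  have hs₁ : L (ρ (lin v)) = r₁ * L n := by rw [H.s_eq, map_mul]
  have hs₂ : R (σ (lin v)) = r₂ * R n' := by rw [H'.s_eq, map_mul]
  have tw₀ : (G₀ k).tensor ρ σ (lin w) = r₁ + r₂ := by
    rw [tensor_apply, G₀_lin, map_add, hout, hout]
    simp only [map_one, mul_one, one_mul]
    rfl
  have tv₀ : (G₀ k).tensor ρ σ (lin v) = r₁ * L n + r₂ * R n' := by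
    rw [tensor_apply, G₀_lin, map_add, hout, hout, hs₁, hs₂]
    simp only [map_one, mul_one, one_mul]
  have tw : G.tensor ρ σ (lin w) = r₁ + r₂ + θ * (r₁ * r₂) := by
    rw [tensor_apply, comul_eq G (aug_lin w), map_add, map_add, hθ, hout, hout]
    simp only [map_one, mul_one, one_mul]
    rfl
  set d' := d * (v 0 * w 1 - v 1 * w 0)⁻¹ with hd'
  have hS' : S = lin v + d' • (lin w * lin v) := by
    rw [hS, x_mul_y_eq hvw, smul_smul]
  have hrs : lin w * S = lin w * lin v := by
    rw [hS', mul_add, mul_smul_comm, ← mul_assoc, lin_mul_self, zero_mul, smul_zero, add_zero]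
  have hvS : lin v = S - d' • (lin w * S) := by
    rw [hrs, hS', add_sub_cancel_right]
  have hρS : ρ S = ρ (lin v) := by
    rw [hS', map_add, map_smul, map_mul, H.s_eq, ← mul_assoc, ← map_mul, lin_mul_self]
    simp
  have hσS : σ S = σ (lin v) := by
    rw [hS', map_add, map_smul, map_mul, H'.s_eq, ← mul_assoc, ← map_mul, lin_mul_self]
    simp
  have tS : G.tensor ρ σ S = r₁ * L n + r₂ * R n' + c • (r₁ * L n * (r₂ * R n')) := by
    rw [tensor_apply, hΔ, map_add, map_add, map_smul, hout, hout, hout, hρS, hσS, hs₁, hs₂]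
    simp only [map_one, mul_one, one_mul]
  have tv : G.tensor ρ σ (lin v) = r₁ * L n + r₂ * R n' +
      (c • (L n * R n') + (-d') • (L n + R n')) * (r₁ * r₂) := by
    nth_rewrite 1 [hvS]
    rw [map_sub, map_smul, map_mul, tS, tw]
    simp only [mul_add, add_mul, smul_mul_assoc, mul_smul_comm, mul_assoc, T.zero₁,
      T.zero₂, T.r₂r₁.left_comm, T.n₁r₁.left_comm, T.n₁r₂.eq,
      T.n₁r₂.left_comm, T.n₂r₁.left_comm, T.n₂r₂.eq, mul_zero, smul_zero, smul_add]
    module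
  set X := TwistData.twist r₁ r₂ (L n) (L e) (R e') (R h') θ c (-d') with hX
  have hu : IsUnit (1 + X) := (T.isNilpotent_twist c (-d')).isUnit_one_add
  obtain ⟨U, hU⟩ := hu
  have hrX : ∀ z, z * (r₁ * r₂) * X = 0 := fun z => by
    rw [mul_assoc, hX, T.mul_twist, mul_zero]
  let φ : M ⊗[k] N ≃ₗ[k] M ⊗[k] N := LinearMap.GeneralLinearGroup.toLinearEquiv U
  have hφ : ∀ z, φ z = (1 + X) z := fun z => by rw [← hU]; rfl
  have h₁ : (1 + X) * (G₀ k).tensor ρ σ (lin v) = G.tensor ρ σ (lin v) * (1 + X) := by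
    rw [tv₀, tv]
    exact one_add_mul_of_mul_eq (T.twist_mul_nilp c (-d')) (hrX _)
  have h₂ : (1 + X) * (G₀ k).tensor ρ σ (lin w) = G.tensor ρ σ (lin w) * (1 + X) := by
    rw [tw₀, tw]
    exact one_add_mul_of_mul_eq (T.twist_mul_sum c (-d')) (hrX _)
  refine repIso_of_lin hvw φ (fun z => ?_) (fun z => ?_)
  · rw [hφ, hφ]
    exact LinearMap.congr_fun h₁ z
  · rw [hφ, hφ]
    exact LinearMap.congr_fun h₂ z

/-! ### Nilpotent endomorphisms -/

section Nilpotent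

variable {k : Type*} [Field k]

theorem exists_grading_matrix {ι : Type*} [Fintype ι] [DecidableEq ι] {N : Matrix ι ι k}
    (hN : IsNilpotent N) : ∃ h : Matrix ι ι k, h * N = N * h + N := by
  let L : Matrix ι ι k →ₗ[k] Matrix ι ι k := LinearMap.mulRight k N - LinearMap.mulLeft k N
  have hL : ∀ X, L X = X * N - N * X := fun X => rfl
  suffices h : N ∈ LinearMap.range L by
    obtain ⟨h, hh⟩ := h
    refine ⟨h, ?_⟩
    rw [hL] at hh
    nth_rewrite 3 [← hh]
    abel
  by_contra hmem
  obtain ⟨f, hfN, hf⟩ := Submodule.exists_le_ker_of_notMem hmem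
  -- `f` is the trace form with a matrix `C`, which has to commute with `N`
  obtain ⟨C, hC⟩ : ∃ C : Matrix ι ι k, ∀ X, f X = (C * X).trace := by
    refine ⟨Matrix.of fun j i => f (Matrix.single i j 1), fun X => ?_⟩
    have : ∀ i j, f (Matrix.single i j (X i j)) = X i j * f (Matrix.single i j 1) := by
      intro i j
      rw [← smul_eq_mul, ← map_smul, Matrix.smul_single, smul_eq_mul, mul_one]
    conv_lhs => rw [Matrix.matrix_eq_sum_single X]
    simp only [map_sum, this, Matrix.trace, Matrix.diag, Matrix.mul_apply, Matrix.of_apply]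
    rw [Finset.sum_comm]
    exact Finset.sum_congr rfl fun i _ => Finset.sum_congr rfl fun j _ => mul_comm _ _
  have hcomm : N * C = C * N := by
    rw [Matrix.ext_iff_trace_mul_right]
    intro X
    have h0 : f (L X) = 0 := hf ⟨X, rfl⟩
    rw [hL, map_sub, hC, hC, sub_eq_zero] at h0
    rw [mul_assoc N C X, Matrix.trace_mul_comm, mul_assoc C X N, h0, mul_assoc]
  apply hfN
  rw [hC]
  exact (Matrix.isNilpotent_trace_of_isNilpotent
    (Commute.isNilpotent_mul_left (show Commute C N from hcomm.symm) hN)).eq_zero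

/-- A nilpotent endomorphism `N` has a grading operator `h`, with `[h, N] = N`: in the trace form,
`N` is orthogonal to its centralizer, which is the orthogonal complement of the image of
`X ↦ [X, N]`. -/
theorem exists_grading {W : Type*} [AddCommGroup W] [Module k W] [FiniteDimensional k W]
    {N : Module.End k W} (hN : IsNilpotent N) : ∃ h : Module.End k W, h * N = N * h + N := by
  let b := Module.finBasis k W
  let e := LinearMap.toMatrixAlgEquiv b
  obtain ⟨h, hh⟩ := exists_grading_matrix (hN.map e)
  refine ⟨e.symm h, e.injective ?_⟩
  simpa using hh

theorem isNilpotent_of_eigenvalue [IsAlgClosed k] {W : Type*} [AddCommGroup W] [Module k W]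
    [FiniteDimensional k W] {N : Module.End k W} (hN : ∀ c, N.HasEigenvalue c → c = 0) :
    IsNilpotent N := by
  have hs := (IsAlgClosed.splits (minpoly k N)).eq_prod_roots_of_monic
    (minpoly.monic (Algebra.IsIntegral.isIntegral N))
  have hr : (minpoly k N).roots = Multiset.replicate (Multiset.card (minpoly k N).roots) 0 := by
    rw [Multiset.eq_replicate]
    exact ⟨rfl, fun c hc =>
      hN c (Module.End.hasEigenvalue_of_isRoot (Polynomial.isRoot_of_mem_roots hc))⟩
  refine ⟨Multiset.card (minpoly k N).roots, ?_⟩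
  have h0 := minpoly.aeval k N
  rw [hs, hr] at h0
  simpa using h0

end Nilpotent

/-! ### Modules supported at one point -/

open KAlg GroupStructure

section Structure

variable {k : Type u} [Field k] {M : Type v} [AddCommGroup M] [Module k M]

/-- Every linear element independent of `lin v` has its kernel inside its image: the module is free
over `k[lin w]` for all `[w] ≠ [v]`. -/
def ExactOff (ρ : KAlg k →ₐ[k] Module.End k M) (v : Fin 2 → k) : Prop :=
  ∀ w, LinearIndependent k ![v, w] → ∀ z, ρ (lin w) z = 0 → ∃ m, ρ (lin w) m = z

theorem exists_of_isFreeAlong [CharP k 2] {ρ : KAlg k →ₐ[k] Module.End k M} {w : Fin 2 → k}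
    (h : IsFreeAlong (linearPoint w) ρ) {z : M} (hz : ρ (lin w) z = 0) :
    ∃ m, ρ (lin w) m = z := by
  let : Module k[ε] M := Module.compHom M (ρ.comp (linearPoint w)).toRingHom
  have hfree : Module.Free k[ε] M := h
  have hsm : ∀ (a : k[ε]) (m : M), a • m = ρ (linearPoint w a) m := fun a m => rfl
  have heps : ∀ m : M, (DualNumber.eps : k[ε]) • m = ρ (lin w) m := fun m => by
    rw [hsm, linearPoint_eps]; rfl
  let b := Module.Free.chooseBasis k[ε] M
  have h0 : ∀ i, (DualNumber.eps : k[ε]) * b.repr z i = 0 := by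
    intro i
    have : (DualNumber.eps : k[ε]) • z = 0 := by rw [heps, hz]
    have := congrArg (fun m => b.repr m i) this
    simpa using this
  have h1 : ∀ i, b.repr z i = DualNumber.eps * TrivSqZeroExt.inl (b.repr z i).snd := by
    intro i
    have := congrArg TrivSqZeroExt.snd (h0 i)
    ext
    · simpa using this
    · simp
  let g : Module.Free.ChooseBasisIndex k[ε] M →₀ k[ε] :=
    (b.repr z).mapRange (fun a => TrivSqZeroExt.inl a.snd) (by simp)
  refine ⟨b.repr.symm g, ?_⟩
  rw [← heps, ← map_smul, LinearEquiv.symm_apply_eq]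
  ext1 i
  rw [h1 i]
  rfl

theorem exactOff_of_support [CharP k 2] {ρ : KAlg k →ₐ[k] Module.End k M}
    {p : ℙ k (Fin 2 → k)} (h : support ρ = {p}) : ExactOff ρ p.rep := by
  intro w hw z hz
  have hw0 : w ≠ 0 := by simpa using hw.ne_zero 1
  have hne : Projectivization.mk k w hw0 ≠ p := by
    intro hp
    have := Projectivization.mk_eq_mk_iff' k w p.rep hw0 p.rep_nonzero
    rw [Projectivization.mk_rep, hp] at this
    obtain ⟨a, ha⟩ := this.1 rfl
    have := LinearIndependent.pair_iff.1 hw a (-1) (by rw [ha]; simp)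
    simpa using this.2
  have hfree : IsFreeAlong (linearPoint (Projectivization.mk k w hw0).rep) ρ := by
    by_contra hf
    have : Projectivization.mk k w hw0 ∈ support ρ := hf
    rw [h] at this
    exact hne this
  obtain ⟨a, ha⟩ := Projectivization.exists_smul_eq_mk_rep k w hw0
  rw [← ha] at hfree
  have ha' : lin ((a : k) • w) = (a : k) • lin w := lin_smul _ _
  obtain ⟨m, hm⟩ := exists_of_isFreeAlong (w := a • w) hfree (z := z) (by
    change ρ (lin ((a : k) • w)) z = 0
    rw [ha', map_smul, LinearMap.smul_apply, hz, smul_zero])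
  refine ⟨(a : k) • m, ?_⟩
  rw [← hm]
  change _ = ρ (lin ((a : k) • w)) m
  rw [ha', map_smul, map_smul, LinearMap.smul_apply]

/-- A vector that is not killed by the socle of `A` generates a free summand: `A` is
self-injective, with Frobenius form the coefficient of `xy`. -/
theorem exists_split [CharP k 2] [FiniteDimensional k M] (ρ : KAlg k →ₐ[k] Module.End k M)
    (h : ρ (x k * y k) ≠ 0) : ∃ (M' : Submodule k M) (ρ' : KAlg k →ₐ[k] Module.End k M'),
      RepIso ρ (repSum (regularRep k (KAlg k)) ρ') ∧
      Module.finrank k M' < Module.finrank k M := by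
  obtain ⟨z, hz⟩ : ∃ z, ρ (x k * y k) z ≠ 0 := by
    by_contra! hc
    exact h (LinearMap.ext hc)
  obtain ⟨f, hf⟩ : ∃ f : Module.Dual k M, f (ρ (x k * y k) z) = 1 := by
    obtain ⟨f, hf⟩ : ∃ f : Module.Dual k M, f (ρ (x k * y k) z) ≠ 0 := by
      by_contra! hc
      exact hz ((Module.forall_dual_apply_eq_zero_iff k _).1 hc)
    exact ⟨(f (ρ (x k * y k) z))⁻¹ • f, by
      rw [LinearMap.smul_apply, smul_eq_mul, inv_mul_cancel₀ hf]⟩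
  have hx := x_mul_x k
  have hy := y_mul_y k
  -- the `A`-linear map to `A` whose coefficient of `xy` is `f`
  let Λ₀ : M →ₗ[k] KAlg k :=
    { toFun := fun m => f (ρ (x k * y k) m) • 1 + f (ρ (y k) m) • x k + f (ρ (x k) m) • y k +
        f m • (x k * y k)
      map_add' := fun m n => by simp only [map_add]; module
      map_smul' := fun c m => by
        simp only [map_smul, smul_eq_mul, RingHom.id_apply]; module }
  have hΛ₀ : ∀ m, Λ₀ m = f (ρ (x k * y k) m) • 1 + f (ρ (y k) m) • x k + f (ρ (x k) m) • y k +
        f m • (x k * y k) := fun m => rfl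
  have hΛx : ∀ m, Λ₀ (ρ (x k) m) = x k * Λ₀ m := by
    intro m
    simp only [hΛ₀, ← Module.End.mul_apply, ← map_mul, mul_add, mul_smul_comm, hx, ← mul_assoc,
      mul_comm (y k) (x k), mul_one, zero_mul, smul_zero]
    rw [mul_comm (x k) (y k), mul_assoc, hx]
    simp
  have hΛy : ∀ m, Λ₀ (ρ (y k) m) = y k * Λ₀ m := by
    intro m
    simp only [hΛ₀, ← Module.End.mul_apply, ← map_mul, mul_add, mul_smul_comm, hy, mul_assoc,
      mul_comm (y k) (x k), mul_one, mul_zero, smul_zero]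
    have h4 : y k * (x k * y k) = 0 := by linear_combination x k * hy
    simp [h4]
  have hΛ₀a : ∀ a m, Λ₀ (ρ a m) = a * Λ₀ m := by
    intro a m
    obtain ⟨c₀, c₁, c₂, c₃, rfl⟩ := exists_coord a
    simp [hΛx, hΛy, add_mul, mul_assoc]
  obtain ⟨u, hu⟩ : ∃ u, u * Λ₀ z = 1 := by
    refine ⟨Λ₀ z, ?_⟩
    rw [hΛ₀, hf]
    generalize f (ρ (y k) z) = a
    generalize f (ρ (x k) z) = b
    generalize f z = c
    have h1 : ∀ t : KAlg k, (1 + t) * (1 + t) = 1 + t * t := fun t => by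
      have := add_self_eq_zero' (k := k) t
      linear_combination this
    have h2 : (x k * y k) * (x k * y k) = 0 := by linear_combination (y k * y k) * hx
    have h3 : x k * (x k * y k) = 0 := by linear_combination y k * hx
    have h4 : y k * (x k * y k) = 0 := by linear_combination x k * hy
    have h5 := fun t : KAlg k => add_self_eq_zero' (k := k) t
    rw [one_smul, add_assoc, add_assoc, h1]
    simp only [add_mul, mul_add, smul_mul_smul_comm, hx, hy, h2, h3, h4, mul_comm (x k * y k),
      mul_comm (y k) (x k), smul_zero, add_zero, zero_add, mul_comm b a]
    rw [h5, add_zero]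
  let Λ : M →ₗ[k] KAlg k := (LinearMap.mulLeft k u).comp Λ₀
  have hΛa : ∀ a m, Λ (ρ a m) = a * Λ m := fun a m => by
    change u * Λ₀ (ρ a m) = a * (u * Λ₀ m)
    rw [hΛ₀a]
    ring
  have hΛz : Λ z = 1 := hu
  have hker : ∀ a, ∀ m ∈ LinearMap.ker Λ, ρ a m ∈ LinearMap.ker Λ := fun a m hm => by
    rw [LinearMap.mem_ker] at hm ⊢
    rw [hΛa, hm, mul_zero]
  let ρ' : KAlg k →ₐ[k] Module.End k (LinearMap.ker Λ) :=
    { toFun := fun a => (ρ a).restrict (hker a)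
      map_one' := by ext; simp
      map_mul' := fun a b => by ext; simp
      map_zero' := by ext; simp
      map_add' := fun a b => by ext; simp
      commutes' := fun c => by ext; simp [Module.algebraMap_end_apply] }
  have hρ' : ∀ a m, ((ρ' a m : LinearMap.ker Λ) : M) = ρ a m := fun a m => rfl
  have hm : ∀ m, m - ρ (Λ m) z ∈ LinearMap.ker Λ := fun m => by
    rw [LinearMap.mem_ker, map_sub, hΛa, hΛz, mul_one, sub_self]
  let e : M ≃ₗ[k] KAlg k × LinearMap.ker Λ :=
    { toFun := fun m => (Λ m, ⟨m - ρ (Λ m) z, hm m⟩)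
      map_add' := fun m n => by
        ext
        · simp
        · simp only [map_add, LinearMap.add_apply, Prod.mk_add_mk, Submodule.coe_add]
          abel
      map_smul' := fun c m => by
        ext
        · simp
        · simp [smul_sub]
      invFun := fun p => ρ p.1 z + p.2
      left_inv := fun m => by simp
      right_inv := fun p => by
        obtain ⟨a, n, hn⟩ := p
        rw [LinearMap.mem_ker] at hn
        ext <;> simp [hΛa, hΛz, hn] }
  refine ⟨LinearMap.ker Λ, ρ', ⟨e, fun a m => ?_⟩, ?_⟩
  · change (Λ (ρ a m), (⟨ρ a m - ρ (Λ (ρ a m)) z, hm _⟩ : LinearMap.ker Λ)) =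
      (a * Λ m, ρ' a ⟨m - ρ (Λ m) z, hm m⟩)
    ext
    · exact hΛa a m
    · simp [hΛa, hρ']
  · have := e.finrank_eq
    rw [Module.finrank_prod, finrank_eq] at this
    omega

/-- A module supported at `[v]` without free summands has Loewy length two and is described by a
nilpotent operator. -/
theorem exists_blockOps [CharP k 2] [IsAlgClosed k] [FiniteDimensional k M]
    {ρ : KAlg k →ₐ[k] Module.End k M} {v w : Fin 2 → k} (hvw : LinearIndependent k ![v, w])
    (hex : ExactOff ρ v) (hxy : ρ (x k * y k) = 0) : ∃ e n h, BlockOps ρ v w e n h := by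
  set R := ρ (lin w) with hR
  set s := ρ (lin v) with hs
  have hRR : ∀ m, R (R m) = 0 := fun m => by
    rw [← Module.End.mul_apply, hR, ← map_mul, lin_mul_self, map_zero, LinearMap.zero_apply]
  have hRs : ∀ m, R (s m) = 0 := fun m => by
    rw [← Module.End.mul_apply, hR, hs, ← map_mul, lin_mul_lin, map_smul, hxy, smul_zero,
      LinearMap.zero_apply]
  have hsR : ∀ m, s (R m) = 0 := fun m => by
    rw [← Module.End.mul_apply, hR, hs, ← map_mul, mul_comm, lin_mul_lin, map_smul, hxy, smul_zero,
      LinearMap.zero_apply]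
  obtain ⟨W, hW⟩ := Submodule.exists_isCompl (LinearMap.ker R)
  have hWR : ∀ b : W, R b = 0 → b = 0 := fun b hb => by
    have : (b : M) ∈ LinearMap.ker R ⊓ W := ⟨hb, b.2⟩
    rw [hW.inf_eq_bot, Submodule.mem_bot] at this
    exact Subtype.ext this
  have hdec : ∀ m, ∃ b : W, R m = R b := fun m => by
    have : m ∈ LinearMap.ker R ⊔ W := by rw [hW.sup_eq_top]; trivial
    obtain ⟨a, ha, b, hb, rfl⟩ := Submodule.mem_sup.1 this
    exact ⟨⟨b, hb⟩, by rw [map_add, LinearMap.mem_ker.1 ha, zero_add]⟩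
  -- `M = rW ⊕ W`
  let φ₀ : (W × W) →ₗ[k] M := (R.comp W.subtype).coprod W.subtype
  have hφ₀ : Function.Bijective φ₀ := by
    constructor
    · rw [← LinearMap.ker_eq_bot, LinearMap.ker_eq_bot']
      rintro ⟨a, b⟩ hab
      have hab' : R a + b = 0 := by simpa [φ₀] using hab
      have hb : b = 0 := hWR b (by simpa [hRR] using congrArg R hab')
      have ha : a = 0 := hWR a (by simpa [hb] using hab')
      rw [ha, hb]
      rfl
    · intro m
      have : m ∈ LinearMap.ker R ⊔ W := by rw [hW.sup_eq_top]; trivial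
      obtain ⟨a, ha, b, hb, rfl⟩ := Submodule.mem_sup.1 this
      obtain ⟨a', ha'⟩ := hex w hvw a ha
      obtain ⟨c, hc⟩ := hdec a'
      refine ⟨(c, ⟨b, hb⟩), ?_⟩
      simp only [φ₀, LinearMap.coprod_apply, LinearMap.comp_apply, Submodule.subtype_apply]
      rw [← hc, ← ha']
  let φ : (W × W) ≃ₗ[k] M := LinearEquiv.ofBijective φ₀ hφ₀
  have hφ : ∀ a b : W, φ (a, b) = R a + b := fun a b => by
    simp [φ, φ₀]
  have hsurj : ∀ m, ∃ a b, m = φ (a, b) := fun m =>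
    ⟨(φ.symm m).1, (φ.symm m).2, by simp⟩
  have hRφ : ∀ a b, R (φ (a, b)) = φ (b, 0) := fun a b => by simp [hφ, hRR]
  let N : Module.End k W := (LinearMap.fst k W W).comp
    (φ.symm.toLinearMap.comp (s.comp W.subtype))
  have hN : ∀ b : W, s b = R (N b) := fun b => by
    obtain ⟨m, hm⟩ := hex w hvw (s b) (hRs b)
    obtain ⟨c, hc⟩ := hdec m
    have h1 : s b = φ (c, 0) := by rw [← hm, hc, hφ]; simp
    have h2 : N b = c := by
      change (φ.symm (s b)).1 = c
      rw [h1, LinearEquiv.symm_apply_apply]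
    rw [h2, h1, hφ]
    simp
  have hsφ : ∀ a b, s (φ (a, b)) = φ (N b, 0) := fun a b => by
    rw [hφ, map_add, hsR, hN, hφ]
    simp
  -- `s - c r` is exact for `c ≠ 0`, so `N` has no eigenvalue but zero
  have hnil : IsNilpotent N := by
    refine isNilpotent_of_eigenvalue fun c hc => ?_
    by_contra hc0
    obtain ⟨b, hb⟩ := hc.exists_hasEigenvector
    have hli : LinearIndependent k ![v, v + (-c) • w] := by
      rw [LinearIndependent.pair_iff] at hvw ⊢
      intro p q hpq
      have := hvw (p + q) (q * -c) (by rw [← hpq]; module)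
      have hq : q = 0 := by simpa [hc0] using this.2
      exact ⟨by simpa [hq] using this.1, hq⟩
    have hact : ∀ m, ρ (lin (v + (-c) • w)) m = s m - c • R m := fun m => by
      rw [lin_add, lin_smul, map_add, map_smul, LinearMap.add_apply, LinearMap.smul_apply,
        neg_smul, ← sub_eq_add_neg]
    obtain ⟨m, hm⟩ := hex _ hli b (by
      rw [hact, hN, hb.apply_eq_smul]
      simp)
    apply hb.2
    apply hWR
    rw [← hm, hact, map_sub, map_smul, hRs, hRR]
    simp
  obtain ⟨H, hH⟩ := exists_grading hnil
  let ext' : Module.End k W → Module.End k M := fun f =>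
    φ.toLinearMap.comp ((f.prodMap f).comp φ.symm.toLinearMap)
  have hext : ∀ f a b, ext' f (φ (a, b)) = φ (f a, f b) := fun f a b => by simp [ext']
  let e : Module.End k M :=
    φ.toLinearMap.comp (((LinearMap.inl k W W).comp (LinearMap.fst k W W)).comp φ.symm.toLinearMap)
  have he : ∀ a b, e (φ (a, b)) = φ (a, 0) := fun a b => by simp [e]
  refine ⟨e, ext' N, ext' H, ?_, ?_, ?_, ?_, ?_, ?_, ?_⟩
  · ext m; obtain ⟨a, b, rfl⟩ := hsurj m
    simp only [Module.End.mul_apply, ← hR, hRφ, he]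
  · ext m; obtain ⟨a, b, rfl⟩ := hsurj m
    simp only [Module.End.mul_apply, ← hR, hRφ, he]
    simp
  · ext m; obtain ⟨a, b, rfl⟩ := hsurj m
    simp only [Module.End.mul_apply, ← hR, hRφ, hext, map_zero]
  · ext m; obtain ⟨a, b, rfl⟩ := hsurj m
    simp only [Module.End.mul_apply, he, hext, map_zero]
  · ext m; obtain ⟨a, b, rfl⟩ := hsurj m
    simp only [Module.End.mul_apply, ← hR, hRφ, hext, map_zero]
  · ext m; obtain ⟨a, b, rfl⟩ := hsurj m
    have h1 : ∀ t, H (N t) = N (H t) + N t := fun t => LinearMap.congr_fun hH t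
    simp only [Module.End.mul_apply, LinearMap.add_apply, hext, h1, ← map_add, Prod.mk_add_mk]
  · ext m; obtain ⟨a, b, rfl⟩ := hsurj m
    simp only [Module.End.mul_apply, ← hR, ← hs, hRφ, hext, hsφ]

theorem ExactOff.congr_sum_right {V : Type*} [AddCommGroup V] [Module k V]
    {M' : Type*} [AddCommGroup M'] [Module k M'] {τ : KAlg k →ₐ[k] Module.End k V}
    {ρ : KAlg k →ₐ[k] Module.End k M} {ρ' : KAlg k →ₐ[k] Module.End k M'} {v : Fin 2 → k}
    (hex : ExactOff ρ v) (h : RepIso ρ (repSum τ ρ')) : ExactOff ρ' v := by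
  obtain ⟨e, he⟩ := h
  intro w hw z hz
  obtain ⟨m, hm⟩ := hex w hw (e.symm (0, z)) (by
    apply e.injective
    rw [he, e.apply_symm_apply]
    simp [repSum, hz])
  refine ⟨(e m).2, ?_⟩
  have := congrArg e hm
  rw [he, e.apply_symm_apply] at this
  exact congrArg Prod.snd this

end Structure

/-! ### Agreement of tensor products -/

section Agree

variable {k : Type u} [Field k] [CharP k 2] (G : GroupStructure (aug k))

theorem agree_comm {M N : Type*} [AddCommGroup M] [Module k M] [AddCommGroup N] [Module k N]
    {ρ : KAlg k →ₐ[k] Module.End k M} {σ : KAlg k →ₐ[k] Module.End k N}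
    (h : RepIso ((G₀ k).tensor ρ σ) (G.tensor ρ σ)) :
    RepIso ((G₀ k).tensor σ ρ) (G.tensor σ ρ) :=
  (tensor_comm _ σ ρ).trans (h.trans (tensor_comm _ ρ σ))

variable {G}

/-- If the tensor products of `G₀` and `G` with a fixed module agree on the modules supported at
`[v]` of Loewy length two, then they agree on all modules supported at `[v]`. -/
theorem agree_of_loewy_two {N : Type*} [AddCommGroup N] [Module k N] [FiniteDimensional k N]
    {σ : KAlg k →ₐ[k] Module.End k N} {v : Fin 2 → k}
    (h : ∀ (M : Type v) [AddCommGroup M] [Module k M] [FiniteDimensional k M]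
      (ρ : KAlg k →ₐ[k] Module.End k M), ExactOff ρ v → ρ (x k * y k) = 0 →
      RepIso ((G₀ k).tensor ρ σ) (G.tensor ρ σ))
    (M : Type v) [AddCommGroup M] [Module k M] [FiniteDimensional k M]
    (ρ : KAlg k →ₐ[k] Module.End k M) (hρ : ExactOff ρ v) :
    RepIso ((G₀ k).tensor ρ σ) (G.tensor ρ σ) := by
  induction hd : Module.finrank k M using Nat.strong_induction_on generalizing M with
  | _ d ih =>
    by_cases h0 : ρ (x k * y k) = 0
    · exact h M ρ hρ h0
    · obtain ⟨M', ρ', hiso, hlt⟩ := exists_split ρ h0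
      have h' := ih _ (hd ▸ hlt) M' ρ' (hρ.congr_sum_right hiso) rfl
      have hP : RepIso ((G₀ k).tensor (regularRep k (KAlg k)) σ)
          (G.tensor (regularRep k (KAlg k)) σ) :=
        (regular_tensor _ σ).symm.trans (regular_tensor _ σ)
      exact ((tensor_congr _ hiso (RepIso.refl σ)).trans (tensor_sum_left _ _ _ _)).trans
        ((hP.sum h').trans ((tensor_sum_left _ _ _ _).symm.trans
          (tensor_congr _ hiso.symm (RepIso.refl σ))))

omit [CharP k 2] in
theorem exists_linearIndependent_pair {v : Fin 2 → k} (hv : v ≠ 0) :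
    ∃ w, LinearIndependent k ![v, w] := by
  by_cases h0 : v 0 = 0
  · refine ⟨![1, 0], LinearIndependent.pair_iff.2 fun a b hab => ?_⟩
    have h1 := congrFun hab 0
    have h2 := congrFun hab 1
    have hv1 : v 1 ≠ 0 := fun h => hv (by ext i; fin_cases i; exacts [h0, h])
    simp [h0, hv1] at h1 h2
    exact ⟨h2, h1⟩
  · refine ⟨![0, 1], LinearIndependent.pair_iff.2 fun a b hab => ?_⟩
    have h1 := congrFun hab 0
    have h2 := congrFun hab 1
    simp [h0] at h1 h2
    subst h1
    exact ⟨rfl, by simpa using h2⟩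

theorem nobleCorrespondence_G₀ [IsAlgClosed k] (G : GroupStructure (aug k)) :
    NobleCorrespondence.{u, v} (G₀ k) G := by
  intro p _ hp M N _ _ _ _ _ _ ρ σ hρ hσ
  obtain ⟨S, d, c, hS, hΔ⟩ := exists_of_isNobleAt p.rep_nonzero hp
  obtain ⟨w, hw⟩ := exists_linearIndependent_pair p.rep_nonzero
  refine agree_of_loewy_two (v := p.rep) (fun M _ _ _ ρ hρ hρ0 => ?_) M ρ (exactOff_of_support hρ)
  refine agree_comm G (agree_of_loewy_two (v := p.rep) (fun N _ _ _ σ hσ hσ0 => ?_) N σ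
    (exactOff_of_support hσ))
  obtain ⟨e, n, h, H⟩ := exists_blockOps hw hρ hρ0
  obtain ⟨e', n', h', H'⟩ := exists_blockOps hw hσ hσ0
  exact H'.repIso_tensor hw G hS hΔ H

theorem propertyPA_G₀ [IsAlgClosed k] : PropertyPA.{u, v} (G₀ k) :=
  ⟨fun p => by
    obtain ⟨w, hw⟩ := exists_linearIndependent_pair p.rep_nonzero
    exact isNobleAt_G₀ hw, nobleCorrespondence_G₀⟩

end Agree

/-! ### The tensor square of a Jordan block -/

section Jordan

variable (k : Type u) [Field k] (n : ℕ)

/-- The nilpotent Jordan block as an endomorphism of `k^n`. -/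
noncomputable def shift : Module.End k (Fin n → k) := Matrix.toLin' (jordan k n)

variable {k n}

/-- The coordinates of a vector, extended by zero. -/
noncomputable def coordExt (b : Fin n → k) (m : ℕ) : k := if h : m < n then b ⟨m, h⟩ else 0

theorem shift_apply (b : Fin n → k) (i : Fin n) : shift k n b i = coordExt b (i + 1) := by
  simp only [shift, Matrix.toLin'_apply, Matrix.mulVec, dotProduct, jordan, Matrix.of_apply,
    coordExt]
  split_ifs with h
  · rw [Finset.sum_eq_single ⟨i + 1, h⟩]
    · simp
    · intro j _ hj
      rw [if_neg, zero_mul]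
      intro h'
      exact hj (Fin.ext h'.symm)
    · simp
  · refine Finset.sum_eq_zero fun j _ => ?_
    rw [if_neg, zero_mul]
    intro h'
    have := j.2
    omega

theorem coordExt_shift (b : Fin n → k) (m : ℕ) :
    coordExt (shift k n b) m = coordExt b (m + 1) := by
  by_cases h : m < n
  · rw [coordExt, dif_pos h, shift_apply]
  · rw [coordExt, coordExt, dif_neg h, dif_neg (by omega)]

variable (k n) in
/-- The standard basis vector `e_m` of `k^n`; zero for `m ≥ n`. -/
def stdVec (m : ℕ) : Fin n → k := fun i => if (i : ℕ) = m then 1 else 0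

theorem shift_stdVec_zero : shift k n (stdVec k n 0) = 0 := by
  ext i
  simp [shift_apply, coordExt, stdVec]

theorem shift_stdVec_succ {m : ℕ} (h : m + 1 < n) :
    shift k n (stdVec k n (m + 1)) = stdVec k n m := by
  ext i
  simp only [shift_apply, coordExt, stdVec]
  split_ifs <;> first | rfl | omega

theorem sum_coordExt (b : Fin n → k) : ∑ j ∈ Finset.range n, coordExt b j • stdVec k n j = b := by
  ext i
  rw [Finset.sum_apply, Finset.sum_eq_single (i : ℕ)]
  · simp [stdVec, coordExt]
  · intro j _ hj
    simp [stdVec, hj.symm]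
  · intro h
    exact absurd (Finset.mem_range.2 i.2) h

variable (k n) in
/-- The comultiplication of divided powers, `e_m ↦ ∑_{i + j = m} e_i ⊗ e_j`. -/
noncomputable def divComul : (Fin n → k) →ₗ[k] (Fin n → k) ⊗[k] (Fin n → k) where
  toFun b := ∑ i ∈ Finset.range n, ∑ j ∈ Finset.range n,
    coordExt b (i + j) • (stdVec k n i ⊗ₜ stdVec k n j)
  map_add' a b := by
    simp only [← Finset.sum_add_distrib, ← add_smul]
    refine Finset.sum_congr rfl fun i _ => Finset.sum_congr rfl fun j _ => ?_
    congr 1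
    simp only [coordExt]
    split_ifs <;> simp
  map_smul' c b := by
    simp only [Finset.smul_sum, smul_smul, RingHom.id_apply]
    refine Finset.sum_congr rfl fun i _ => Finset.sum_congr rfl fun j _ => ?_
    congr 1
    simp only [coordExt]
    split_ifs <;> simp

theorem divComul_apply (b : Fin n → k) : divComul k n b = ∑ i ∈ Finset.range n,
    ∑ j ∈ Finset.range n, coordExt b (i + j) • (stdVec k n i ⊗ₜ stdVec k n j) := rfl

variable (k n) in
/-- The Jordan block acting on the first factor of `k^n ⊗ k^n`. -/
noncomputable def shiftLeft : Module.End k ((Fin n → k) ⊗[k] (Fin n → k)) :=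
  TensorProduct.map (shift k n) LinearMap.id

variable (k n) in
/-- The Jordan block acting on the second factor of `k^n ⊗ k^n`. -/
noncomputable def shiftRight : Module.End k ((Fin n → k) ⊗[k] (Fin n → k)) :=
  TensorProduct.map LinearMap.id (shift k n)

theorem shiftLeft_divComul (b : Fin n → k) :
    shiftLeft k n (divComul k n b) = divComul k n (shift k n b) := by
  cases n with
  | zero => simp [divComul_apply]
  | succ m =>
    rw [divComul_apply, divComul_apply]
    conv_lhs => rw [Finset.sum_range_succ', map_add, map_sum]
    conv_rhs => rw [Finset.sum_range_succ]
    congr 1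
    · refine Finset.sum_congr rfl fun i hi => ?_
      rw [map_sum]
      refine Finset.sum_congr rfl fun j _ => ?_
      have hi' := Finset.mem_range.1 hi
      rw [map_smul, shiftLeft, TensorProduct.map_tmul, shift_stdVec_succ (by omega),
        coordExt_shift, LinearMap.id_apply, add_right_comm]
    · rw [map_sum]
      trans (0 : (Fin (m + 1) → k) ⊗[k] (Fin (m + 1) → k))
      · refine Finset.sum_eq_zero fun j _ => ?_
        rw [map_smul, shiftLeft, TensorProduct.map_tmul, shift_stdVec_zero,
          TensorProduct.zero_tmul, smul_zero]
      · refine (Finset.sum_eq_zero fun j _ => ?_).symm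
        rw [coordExt_shift, coordExt, dif_neg (by omega), zero_smul]

theorem comm_divComul (b : Fin n → k) :
    TensorProduct.comm k _ _ (divComul k n b) = divComul k n b := by
  rw [divComul_apply, map_sum]
  simp only [map_sum, map_smul, TensorProduct.comm_tmul]
  rw [Finset.sum_comm]
  simp only [add_comm]

theorem shiftRight_divComul (b : Fin n → k) :
    shiftRight k n (divComul k n b) = divComul k n (shift k n b) := by
  have h : ∀ t, shiftRight k n (TensorProduct.comm k _ _ t) =
      TensorProduct.comm k _ _ (shiftLeft k n t) := by
    intro t
    induction t with
    | zero => simp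
    | add x y hx hy => simp only [map_add, hx, hy]
    | tmul x y => simp [shiftLeft, shiftRight]
  rw [← comm_divComul b, h, shiftLeft_divComul, comm_divComul]

theorem divComul_injective : Function.Injective (divComul k n) := by
  cases n with
  | zero => exact Function.injective_of_subsingleton _
  | succ m =>
    let π : (Fin (m + 1) → k) ⊗[k] (Fin (m + 1) → k) →ₗ[k] (Fin (m + 1) → k) :=
      (TensorProduct.lid k _).toLinearMap.comp (TensorProduct.map (LinearMap.proj 0) LinearMap.id)
    have hπ : ∀ b, π (divComul k (m + 1) b) = b := by
      intro b
      rw [divComul_apply, map_sum, Finset.sum_eq_single 0]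
      · nth_rewrite 2 [← sum_coordExt b]
        rw [map_sum]
        refine Finset.sum_congr rfl fun j _ => ?_
        simp [π, stdVec]
      · intro i _ hi
        rw [map_sum]
        refine Finset.sum_eq_zero fun j _ => ?_
        simp [π, stdVec, hi.symm]
      · simp
    exact Function.LeftInverse.injective hπ

variable (k n) in
/-- The sum of the Jordan blocks on the two factors. -/
noncomputable def shiftSum : Module.End k ((Fin n → k) ⊗[k] (Fin n → k)) :=
  shiftLeft k n + shiftRight k n

variable (k n) in
/-- `b ↦ b ⊗ e_{n-1}`: its image is a complement of the image of the sum of the Jordan blocks. -/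
noncomputable def topVec : (Fin n → k) →ₗ[k] (Fin n → k) ⊗[k] (Fin n → k) :=
  (TensorProduct.mk k _ _).flip (stdVec k n (n - 1))

theorem topVec_apply (b : Fin n → k) : topVec k n b = b ⊗ₜ stdVec k n (n - 1) := rfl

theorem shiftLeft_topVec (b : Fin n → k) :
    shiftLeft k n (topVec k n b) = topVec k n (shift k n b) := by
  simp [shiftLeft, topVec_apply]

theorem range_topVec_sup : LinearMap.range (topVec k n) ⊔ LinearMap.range (shiftSum k n) = ⊤ := by
  set X := LinearMap.range (topVec k n) ⊔ LinearMap.range (shiftSum k n)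
  have key : ∀ d a, d < n → a ⊗ₜ[k] stdVec k n (n - 1 - d) ∈ X := by
    intro d
    induction d with
    | zero => exact fun a _ => Submodule.mem_sup_left ⟨a, rfl⟩
    | succ d ih =>
      intro a hd
      have e : n - 1 - d = (n - 1 - (d + 1)) + 1 := by omega
      have h1 : a ⊗ₜ[k] stdVec k n (n - 1 - (d + 1)) =
          shiftSum k n (a ⊗ₜ stdVec k n (n - 1 - d)) -
            (shift k n a) ⊗ₜ stdVec k n (n - 1 - d) := by
        rw [shiftSum, LinearMap.add_apply, shiftLeft, shiftRight, TensorProduct.map_tmul,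
          TensorProduct.map_tmul]
        have h0 : shift k n (stdVec k n (n - 1 - d)) = stdVec k n (n - 1 - (d + 1)) := by
          rw [e]
          exact shift_stdVec_succ (by omega)
        rw [h0]
        simp
      rw [h1]
      exact sub_mem (Submodule.mem_sup_right ⟨_, rfl⟩) (ih _ (by omega))
  rw [eq_top_iff, ← TensorProduct.span_tmul_eq_top, Submodule.span_le]
  rintro _ ⟨a, b, rfl⟩
  rw [← sum_coordExt b, TensorProduct.tmul_sum]
  refine sum_mem fun j hj => ?_
  rw [TensorProduct.tmul_smul]
  have hj' := Finset.mem_range.1 hj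
  have := key (n - 1 - j) a (by omega)
  rw [show n - 1 - (n - 1 - j) = j by omega] at this
  exact Submodule.smul_mem _ _ this

variable [CharP k 2]

theorem shiftSum_divComul (b : Fin n → k) : shiftSum k n (divComul k n b) = 0 := by
  rw [shiftSum, LinearMap.add_apply, shiftLeft_divComul, shiftRight_divComul,
    add_self_eq_zero' (k := k)]

omit [CharP k 2] in
theorem finrank_tensor_fin :
    Module.finrank k ((Fin n → k) ⊗[k] (Fin n → k)) = n ^ 2 := by
  rw [Module.finrank_tensorProduct, Module.finrank_fin_fun, pow_two]

theorem range_divComul : LinearMap.range (divComul k n) = LinearMap.ker (shiftSum k n) := by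
  apply Submodule.eq_of_le_of_finrank_le
  · rintro _ ⟨b, rfl⟩
    exact shiftSum_divComul b
  · rw [LinearMap.finrank_range_of_inj divComul_injective, Module.finrank_fin_fun]
    have h1 := LinearMap.finrank_range_add_finrank_ker (shiftSum k n)
    have h2 := Submodule.finrank_add_le_finrank_add_finrank (LinearMap.range (topVec k n))
      (LinearMap.range (shiftSum k n))
    have h3 := LinearMap.finrank_range_le (topVec k n)
    rw [range_topVec_sup, finrank_top] at h2
    rw [Module.finrank_fin_fun] at h3
    omega

theorem finrank_ker_shiftSum : Module.finrank k (LinearMap.ker (shiftSum k n)) = n := by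
  rw [← range_divComul, LinearMap.finrank_range_of_inj divComul_injective, Module.finrank_fin_fun]

end Jordan

/-! ### The noble square of `V_{2n}` -/

section Square

open KAlg GroupStructure

variable {k : Type u} [Field k] [CharP k 2] {n : ℕ} {v w : Fin 2 → k}

omit [CharP k 2] in
theorem V_lin_right (h : LinearIndependent k ![v, w]) (m : (Fin n → k) × (Fin n → k)) :
    V n v w (lin w) m = (m.2, 0) := by
  rw [lin, V_s₁ n h]
  simp

omit [CharP k 2] in
theorem V_lin_left (h : LinearIndependent k ![v, w]) (m : (Fin n → k) × (Fin n → k)) :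
    V n v w (lin v) m = (shift k n m.2, 0) := by
  rw [lin, V_s₂ n h, block_apply]
  rfl

omit [CharP k 2] in
theorem exists_blockOps_V (hvw : LinearIndependent k ![v, w]) (n : ℕ) :
    ∃ e m h, BlockOps (V n v w) v w e m h := by
  let H : Module.End k (Fin n → k) :=
    LinearMap.pi fun i => (-(i : ℕ) : k) • LinearMap.proj i
  have hH : ∀ b i, H b i = (-(i : ℕ) : k) * b i := fun b i => rfl
  have hHN : ∀ b, H (shift k n b) = shift k n (H b) + shift k n b := by
    intro b
    ext i
    rw [Pi.add_apply, hH, shift_apply, shift_apply, coordExt, coordExt]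
    split_ifs
    · rw [hH]
      push_cast
      ring
    · simp
  refine ⟨(LinearMap.inl k _ _).comp (LinearMap.fst k _ _), (shift k n).prodMap (shift k n),
    H.prodMap H, ?_, ?_, ?_, ?_, ?_, ?_, ?_⟩
  · refine LinearMap.ext fun m => ?_
    simp [V_lin_right hvw]
  · refine LinearMap.ext fun m => ?_
    simp [V_lin_right hvw]
  · refine LinearMap.ext fun m => ?_
    simp [V_lin_right hvw]
  · refine LinearMap.ext fun m => ?_
    simp
  · refine LinearMap.ext fun m => ?_
    simp [V_lin_right hvw]
  · refine LinearMap.ext fun m => ?_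
    simp [hHN]
  · refine LinearMap.ext fun m => ?_
    simp [V_lin_right hvw, V_lin_left hvw]

omit [CharP k 2] in
theorem BlockOps.smul {M : Type*} [AddCommGroup M] [Module k M]
    {ρ : KAlg k →ₐ[k] Module.End k M} {e m h : Module.End k M} (H : BlockOps ρ v w e m h) (c : k) :
    BlockOps ρ (c • v) w e (c • m) h where
  er := H.er
  re := H.re
  nr := H.nr.smul_left c
  ne := H.ne.smul_left c
  hr := H.hr
  hn := by rw [mul_smul_comm, H.hn, smul_mul_assoc, smul_add]
  s_eq := by rw [lin_smul, map_smul, H.s_eq, mul_smul_comm]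

/-- The tensor square of `V_{2n}` for `G₀`. With `T = k^n ⊗ k^n` and `D` the sum of the two Jordan
blocks on `T`, one copy of `V_{2n}` is generated by the kernel of `D` in the top of
`V_{2n} ⊗ V_{2n}`, one by a complement of the image of `D`, and a complement of the kernel of `D`
generates a free module. -/
theorem square_G₀ (hvw : LinearIndependent k ![v, w]) (n : ℕ) :
    RepIso ((G₀ k).tensor (V n v w) (V n v w))
      (repSum (repMul 2 (V n v w)) (repMul (n ^ 2 - n) (regularRep k (KAlg k)))) := by
  set τ := (G₀ k).tensor (V n v w) (V n v w) with hτ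
  -- the four summands of `V_{2n} ⊗ V_{2n}`
  let J₀ := TensorProduct.map (LinearMap.inr k (Fin n → k) (Fin n → k))
    (LinearMap.inr k (Fin n → k) (Fin n → k))
  let J₁ := TensorProduct.map (LinearMap.inl k (Fin n → k) (Fin n → k))
    (LinearMap.inr k (Fin n → k) (Fin n → k))
  let J₂ := TensorProduct.map (LinearMap.inr k (Fin n → k) (Fin n → k))
    (LinearMap.inl k (Fin n → k) (Fin n → k))
  let J₃ := TensorProduct.map (LinearMap.inl k (Fin n → k) (Fin n → k))
    (LinearMap.inl k (Fin n → k) (Fin n → k))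
  have hw : ∀ a b, τ (lin w) (a ⊗ₜ b) = (a.2, 0) ⊗ₜ b + a ⊗ₜ (b.2, 0) := fun a b => by
    rw [hτ, tensor_apply, G₀_lin, map_add, LinearMap.add_apply, outer_tmul, outer_tmul,
      TensorProduct.map_tmul, TensorProduct.map_tmul, V_lin_right hvw, V_lin_right hvw]
    simp
  have hv : ∀ a b, τ (lin v) (a ⊗ₜ b) =
      (shift k n a.2, 0) ⊗ₜ b + a ⊗ₜ (shift k n b.2, 0) := fun a b => by
    rw [hτ, tensor_apply, G₀_lin, map_add, LinearMap.add_apply, outer_tmul, outer_tmul,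
      TensorProduct.map_tmul, TensorProduct.map_tmul, V_lin_left hvw, V_lin_left hvw]
    simp
  have hz : ((0, 0) : (Fin n → k) × (Fin n → k)) = 0 := rfl
  have w₀ : ∀ t, τ (lin w) (J₀ t) = J₁ t + J₂ t := fun t => by
    induction t with
    | zero => simp
    | add x y hx hy => simp only [map_add, hx, hy]; abel
    | tmul x y => simp [J₀, J₁, J₂, hw]
  have w₁ : ∀ t, τ (lin w) (J₁ t) = J₃ t := fun t => by
    induction t with
    | zero => simp
    | add x y hx hy => simp only [map_add, hx, hy]
    | tmul x y => simp [J₁, J₃, hw, hz]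
  have w₂ : ∀ t, τ (lin w) (J₂ t) = J₃ t := fun t => by
    induction t with
    | zero => simp
    | add x y hx hy => simp only [map_add, hx, hy]
    | tmul x y => simp [J₂, J₃, hw, hz]
  have w₃ : ∀ t, τ (lin w) (J₃ t) = 0 := fun t => by
    induction t with
    | zero => simp
    | add x y hx hy => simp only [map_add, hx, hy, add_zero]
    | tmul x y => simp [J₃, hw, hz]
  have v₀ : ∀ t, τ (lin v) (J₀ t) = J₁ (shiftLeft k n t) + J₂ (shiftRight k n t) := fun t => by
    induction t with
    | zero => simp
    | add x y hx hy => simp only [map_add, hx, hy]; abel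
    | tmul x y => simp [J₀, J₁, J₂, hv, shiftLeft, shiftRight]
  have v₁ : ∀ t, τ (lin v) (J₁ t) = J₃ (shiftRight k n t) := fun t => by
    induction t with
    | zero => simp
    | add x y hx hy => simp only [map_add, hx, hy]
    | tmul x y => simp [J₁, J₃, hv, hz, shiftRight]
  have v₂ : ∀ t, τ (lin v) (J₂ t) = J₃ (shiftLeft k n t) := fun t => by
    induction t with
    | zero => simp
    | add x y hx hy => simp only [map_add, hx, hy]
    | tmul x y => simp [J₂, J₃, hv, hz, shiftLeft]
  have v₃ : ∀ t, τ (lin v) (J₃ t) = 0 := fun t => by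
    induction t with
    | zero => simp
    | add x y hx hy => simp only [map_add, hx, hy, add_zero]
    | tmul x y => simp [J₃, hv, hz]
  -- a basis of a complement of the kernel of `D`
  obtain ⟨Q, hQ⟩ := Submodule.exists_isCompl (LinearMap.ker (shiftSum k n))
  have hQd : Module.finrank k Q = n ^ 2 - n := by
    have := Submodule.finrank_add_eq_of_isCompl hQ
    rw [finrank_ker_shiftSum, finrank_tensor_fin] at this
    omega
  have : Module.Free k Q := Module.Free.of_divisionRing k Q
  let q := Module.finBasisOfFinrankEq k Q hQd
  let f₀ : (Fin n → k) × (Fin n → k) →ₗ[k] _ :=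
    ((J₁ + J₂).comp (divComul k n)).coprod (J₀.comp (divComul k n))
  let f₁ : (Fin n → k) × (Fin n → k) →ₗ[k] _ :=
    (J₃.comp (topVec k n)).coprod (J₂.comp (topVec k n))
  have hf₀ : ∀ m, f₀ m = J₁ (divComul k n m.1) + J₂ (divComul k n m.1) + J₀ (divComul k n m.2) :=
    fun m => by simp [f₀]
  have hf₁ : ∀ m, f₁ m = J₃ (topVec k n m.1) + J₂ (topVec k n m.2) := fun m => by simp [f₁]
  let g : Fin (n ^ 2 - n) → KAlg k →ₗ[k] _ := fun j =>
    (LinearMap.applyₗ (J₀ (q j))).comp τ.toLinearMap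
  have hg : ∀ j c, g j c = τ c (J₀ (q j)) := fun j c => rfl
  let pr : Fin 2 → (Fin 2 → (Fin n → k) × (Fin n → k)) →ₗ[k] (Fin n → k) × (Fin n → k) :=
    fun i => LinearMap.proj i
  let Ψ : (Fin 2 → (Fin n → k) × (Fin n → k)) × (Fin (n ^ 2 - n) → KAlg k) →ₗ[k] _ :=
    (f₀.comp (pr 0) + f₁.comp (pr 1)).coprod
      (∑ j, (g j).comp (LinearMap.proj j))
  have hΨ : ∀ m c, Ψ (m, c) = f₀ (m 0) + f₁ (m 1) + ∑ j, g j (c j) := fun m c => by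
    simp [Ψ, pr]
  have h2 := fun t : ((Fin n → k) × (Fin n → k)) ⊗[k] ((Fin n → k) × (Fin n → k)) =>
    add_self_eq_zero' (k := k) t
  have hD : ∀ b, shiftSum k n (divComul k n b) = 0 := shiftSum_divComul
  have hsum : ∀ t, shiftRight k n t = shiftSum k n t + shiftLeft k n t := fun t => by
    rw [shiftSum, LinearMap.add_apply, add_right_comm, add_self_eq_zero' (k := k), zero_add]
  have e₀w : ∀ m, f₀ (V n v w (lin w) m) = τ (lin w) (f₀ m) := fun m => by
    simp only [hf₀, V_lin_right hvw, map_add, w₀, w₁, w₂, map_zero, add_zero, h2, zero_add]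
  have e₀v : ∀ m, f₀ (V n v w (lin v) m) = τ (lin v) (f₀ m) := fun m => by
    simp only [hf₀, V_lin_left hvw, map_add, v₀, v₁, v₂, map_zero, add_zero, shiftLeft_divComul,
      shiftRight_divComul, h2, zero_add]
  have e₁w : ∀ m, f₁ (V n v w (lin w) m) = τ (lin w) (f₁ m) := fun m => by
    simp only [hf₁, V_lin_right hvw, map_add, w₂, w₃, map_zero, add_zero, zero_add]
  have e₁v : ∀ m, f₁ (V n v w (lin v) m) = τ (lin v) (f₁ m) := fun m => by
    simp only [hf₁, V_lin_left hvw, map_add, v₂, v₃, map_zero, add_zero, shiftLeft_topVec, zero_add]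
  have eg : ∀ a j c, g j (a * c) = τ a (g j c) := fun a j c => by
    rw [hg, hg, map_mul, Module.End.mul_apply]
  set σ := repSum (repMul 2 (V n v w)) (repMul (n ^ 2 - n) (regularRep k (KAlg k))) with hσ
  have hσ' : ∀ a m c, σ a (m, c) = (fun i => V n v w a (m i), fun j => a * c j) :=
    fun a m c => rfl
  have ew : ∀ z, Ψ (σ (lin w) z) = τ (lin w) (Ψ z) := fun z => by
    obtain ⟨m, c⟩ := z
    simp only [hσ', hΨ, e₀w, e₁w, eg, map_add, map_sum]
  have ev : ∀ z, Ψ (σ (lin v) z) = τ (lin v) (Ψ z) := fun z => by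
    obtain ⟨m, c⟩ := z
    simp only [hσ', hΨ, e₀v, e₁v, eg, map_add, map_sum]
  -- surjectivity
  set X := LinearMap.range Ψ with hX
  have Xw : ∀ z ∈ X, τ (lin w) z ∈ X := by
    rintro _ ⟨z, rfl⟩
    exact ⟨_, ew z⟩
  have Xv : ∀ z ∈ X, τ (lin v) z ∈ X := by
    rintro _ ⟨z, rfl⟩
    exact ⟨_, ev z⟩
  have X₀ : ∀ t, J₀ t ∈ X := by
    intro t
    have ht : t ∈ LinearMap.ker (shiftSum k n) ⊔ Q := by rw [hQ.sup_eq_top]; trivial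
    obtain ⟨a, ha, b, hb, rfl⟩ := Submodule.mem_sup.1 ht
    rw [map_add]
    refine add_mem ?_ ?_
    · rw [← range_divComul] at ha
      obtain ⟨a, rfl⟩ := ha
      exact ⟨(Pi.single 0 (0, a), 0), by simp [hΨ, hf₀, hf₁]⟩
    · have hb' : b = ∑ j, q.repr ⟨b, hb⟩ j • (q j : (Fin n → k) ⊗[k] (Fin n → k)) := by
        have := congrArg Q.subtype (q.sum_repr ⟨b, hb⟩)
        simp only [map_sum, map_smul, Submodule.subtype_apply] at this
        exact this.symm
      rw [hb', map_sum]
      refine sum_mem fun j _ => ?_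
      rw [map_smul]
      refine Submodule.smul_mem _ _ ⟨(0, Pi.single j 1), ?_⟩
      rw [hΨ, Finset.sum_eq_single j]
      · rw [hg, Pi.single_eq_same, map_one, Module.End.one_apply]
        simp only [Pi.zero_apply, map_zero, zero_add]
      · intro i _ hi
        rw [Pi.single_eq_of_ne hi, map_zero]
      · exact fun h => absurd (Finset.mem_univ j) h
  have X₁₂ : ∀ t, J₁ t + J₂ t ∈ X := fun t => w₀ t ▸ Xw _ (X₀ t)
  have X₂ : ∀ t, J₂ t ∈ X := by
    intro t
    have ht : t ∈ LinearMap.range (topVec k n) ⊔ LinearMap.range (shiftSum k n) := by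
      rw [range_topVec_sup]; trivial
    obtain ⟨_, ⟨a, rfl⟩, _, ⟨b, rfl⟩, rfl⟩ := Submodule.mem_sup.1 ht
    rw [map_add]
    refine add_mem ⟨(Pi.single 1 (0, a), 0), by simp [hΨ, hf₀, hf₁]⟩ ?_
    have h3 := sub_mem (Xv _ (X₀ b)) (X₁₂ (shiftLeft k n b))
    rw [v₀, hsum, map_add] at h3
    convert h3 using 1
    abel
  have X₁ : ∀ t, J₁ t ∈ X := fun t => by simpa using sub_mem (X₁₂ t) (X₂ t)
  have X₃ : ∀ t, J₃ t ∈ X := fun t => w₁ t ▸ Xw _ (X₁ t)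
  have surj : Function.Surjective Ψ := by
    rw [← LinearMap.range_eq_top, eq_top_iff, ← TensorProduct.span_tmul_eq_top, Submodule.span_le]
    rintro _ ⟨⟨a, b⟩, ⟨a', b'⟩, rfl⟩
    have hsplit : ((a, b) : (Fin n → k) × (Fin n → k)) ⊗ₜ[k] (a', b') =
        J₀ (b ⊗ₜ b') + J₁ (a ⊗ₜ b') + J₂ (b ⊗ₜ a') + J₃ (a ⊗ₜ a') := by
      have h1 : ∀ a b : Fin n → k, (a, b) = LinearMap.inl k (Fin n → k) (Fin n → k) a +
          LinearMap.inr k (Fin n → k) (Fin n → k) b := fun a b => by simp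
      rw [h1 a b, h1 a' b', TensorProduct.add_tmul, TensorProduct.tmul_add, TensorProduct.tmul_add]
      simp only [J₀, J₁, J₂, J₃, TensorProduct.map_tmul]
      abel
    change _ ∈ X
    rw [hsplit]
    exact add_mem (add_mem (add_mem (X₀ _) (X₁ _)) (X₂ _)) (X₃ _)
  have hdim : Module.finrank k ((Fin 2 → (Fin n → k) × (Fin n → k)) ×
      (Fin (n ^ 2 - n) → KAlg k)) =
      Module.finrank k (((Fin n → k) × (Fin n → k)) ⊗[k] ((Fin n → k) × (Fin n → k))) := by
    have hn : n ≤ n ^ 2 := by nlinarith [Nat.zero_le n, Nat.le_mul_self n]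
    obtain ⟨d, hd⟩ := Nat.exists_eq_add_of_le hn
    rw [Module.finrank_prod, Module.finrank_pi_fintype, Module.finrank_pi_fintype,
      Module.finrank_tensorProduct, Module.finrank_prod, Module.finrank_fin_fun, finrank_eq]
    simp only [Finset.sum_const, Finset.card_univ, Fintype.card_fin, smul_eq_mul]
    rw [hd, Nat.add_sub_cancel_left]
    nlinarith
  have inj : Function.Injective Ψ :=
    (LinearMap.injective_iff_surjective_of_finrank_eq_finrank hdim).2 surj
  exact (repIso_of_lin hvw (ρ := σ) (σ := τ) (LinearEquiv.ofBijective Ψ ⟨inj, surj⟩) ev ew).symm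

/-- The tensor square of `V_{2n}(𝔭)` for a structure for which `𝔭` is noble. -/
theorem square_of_isNoble {G : GroupStructure (aug k)} {p : ℙ k (Fin 2 → k)} (hp : IsNoble G p)
    {v w : Fin 2 → k} (hv : v ≠ 0) (hvp : Projectivization.mk k v hv = p)
    (hvw : LinearIndependent k ![v, w]) (n : ℕ) :
    RepIso (G.tensor (V n v w) (V n v w))
      (repSum (repMul 2 (V n v w)) (repMul (n ^ 2 - n) (regularRep k (KAlg k)))) := by
  obtain ⟨S, d, c, hS, hΔ⟩ := exists_of_isNobleAt p.rep_nonzero hp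
  obtain ⟨a, ha⟩ : ∃ a : kˣ, a • v = p.rep := by
    rw [← hvp]
    exact Projectivization.exists_smul_eq_mk_rep k v hv
  have ha' : (a : k) • v = p.rep := ha
  have hvw' : LinearIndependent k ![p.rep, w] := by
    rw [LinearIndependent.pair_iff] at hvw ⊢
    intro s t hst
    rw [← ha', smul_smul] at hst
    obtain ⟨h1, h2⟩ := hvw _ _ hst
    exact ⟨by simpa using h1, h2⟩
  obtain ⟨e, m, h, H⟩ := exists_blockOps_V hvw n
  have H' := H.smul (a : k)
  rw [ha'] at H'
  exact (H'.repIso_tensor hvw' G hS hΔ H').symm.trans (square_G₀ hvw n)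

end Square

end NobleSquare

theorem theorem3p13 (k : Type u) [Field k] [IsAlgClosed k] [CharP k 2] :
    (∀ G ∈ ({NobleSquare.G₀ k, NobleSquare.G₁ k, NobleSquare.G₂ k, NobleSquare.G₃ k} :
        Set (NobleSquare.GroupStructure (NobleSquare.KAlg.aug k))),
      ∀ p : ℙ k (Fin 2 → k), NobleSquare.IsNoble G p →
      ∀ (v w : Fin 2 → k) (hv : v ≠ 0), Projectivization.mk k v hv = p →
        LinearIndependent k ![v, w] →
      ∀ n : ℕ,
        NobleSquare.RepIso
          (G.tensor (NobleSquare.V n v w) (NobleSquare.V n v w))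
          (NobleSquare.repSum
            (NobleSquare.repMul 2 (NobleSquare.V n v w))
            (NobleSquare.repMul (n ^ 2 - n)
              (NobleSquare.regularRep k (NobleSquare.KAlg k))))) ∧
    (∀ G ∈ ({NobleSquare.G₁ k, NobleSquare.G₂ k, NobleSquare.G₃ k} :
        Set (NobleSquare.GroupStructure (NobleSquare.KAlg.aug k))),
      NobleSquare.NobleCorrespondence.{u, v} (NobleSquare.G₀ k) G) ∧
    NobleSquare.PropertyPA.{u, v} (NobleSquare.G₀ k) :=
  ⟨fun _ _ _ hp _ _ hv hvp hvw n => NobleSquare.square_of_isNoble hp hv hvp hvw n,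
    fun _ _ => NobleSquare.nobleCorrespondence_G₀ _, NobleSquare.propertyPA_G₀⟩
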